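/- **Setting.** Let $k\ge 1$ be fixed. A $k$-local Hamiltonian on $n$ qubits ($d=2^n$) is a sum $H=\sum_{\vec j} H_{\vec j}$ over all tuples $\vec j=(j_1,\dots,j_k)\in\{1,\dots,n\}^k$, where each $H_{\vec j}$ is Hermitian (possibly $0$) and acts as the identity outside the qubits $j_1,\dots,j_k$. We say that $H$ has *exact supports* if every $H_{\vec j}$ is a linear combination of Pauli strings whose support is exactly $\{j_1,\dots,j_k\}$. Let $\|\cdot\|$ be the spectral norm, $\|X\|_F=\sqrt{\mathrm{Tr}(XX^\dagger)}$, $\vec j\setminus l$ the tuple $\vec j$ with its $l$-th entry deleted, and $$\|H\|_1=\sum_{\vec j}\|H_{\vec j}\|,\qquad \|H\|_{1,F}=\sum_{\vec j}\|H_{\vec j}\|_F,\qquad |||H|||_1=\max_{l,\,q}\sum_{\vec j:\,j_l=q}\|H_{\vec j}\|,$$ $$|||H|||_{\mathrm{per}}^2=\max_{l,\,q}\ \sum_{\vec j:\,j_l=q}\|H_{\vec j}\|\,\Bigl(\max_{l',\,q'}\ \sum_{\vec j':\ j'_{l'}=q',\ \vec j'\setminus l'\text{ is a permutation of }\vec j\setminus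 l}\|H_{\vec j'}\|\Bigr).$$ Enumerate the terms in any order as $H_1,\dots,H_L$. The product formulas are $\mathscr U_1(t)=e^{-iH_1t}\cdots e^{-iH_Lt}$, $\mathscr U_2(t)=e^{-iH_1t/2}\cdots e^{-iH_Lt/2}\,e^{-iH_Lt/2}\cdots e^{-iH_1t/2}$ and, for $q\ge2$, $\mathscr U_{2q}(t)=\mathscr U_{2q-2}(p_qt)^2\,\mathscr U_{2q-2}((1-4p_q)t)\,\mathscr U_{2q-2}(p_qt)^2$ with $p_q=1/(4-4^{1/(2q-1)})$. PF$p$ ($p=1$ or $p$ even) approximates $U_0(t)=e^{-iHt}$ by $\mathscr U_p(t/r)^r$. For an ensemble of unit vectors $\psi$ that is a 1-design ($\mathbb E|\psi\rangle\langle\psi|=I/d$), the average error is $R_p=\mathbb E\,\|\mathscr U_p(t/r)^r\psi-U_0(t)\psi\|_2$; the worst-case error is $W_p=\|\mathscr U_p(t/r)^r-U_0(t)\|$. **Claim.** The following hold for all $n$, all $k$-local $H$ (with exact supports where stated), all orderings of the terms, all 1-design ensembles, all real $t\ge0$ and all integers $r\ge1$, where the constants implied by $\mathcal O$ depend only on $k$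 and $p$. 1. If $H$ has exact supports, then for every tuple $\vec i$ $$\bigl\|[H_{\vec i},\textstyle\sum_{\vec j}H_{\vec j}]\bigr\|_F^2=\mathcal O\bigl(\|H_{\vec i}\|_F^2\,|||H|||_{\mathrm{per}}^2\bigr),$$ and if the inner sum is restricted to the tuples $\vec j$ with distinct entries that have exactly one qubit in common with $\vec i$, then the left-hand side is at most $4k^4\|H_{\vec i}\|_F^2|||H|||_{\mathrm{per}}^2$. 2. If $H$ has exact supports, then $$R_1=\mathcal O\Bigl(\tfrac{t^2}{r}\tfrac1{\sqrt d}\|H\|_{1,F}|||H|||_{\mathrm{per}}\Bigr),\qquad R_2=\mathcal O\Bigl(\tfrac{t^3}{r^2}\tfrac1{\sqrt d}\|H\|_{1,F}|||H|||_1|||H|||_{\mathrm{per}}\Bigr).$$ 3. For every even $p>2$, $R_p=\mathcal O\bigl(\tfrac{t^{p+1}}{r^p}\tfrac1{\sqrt d}\|H\|_{1,F}|||H|||_1^{p}\bigr)$ (exact supports are not needed). 4. In the worst case, for $p=1$ and every even $p\ge2$, $W_p=\mathcal O\bigl(\tfrac{t^{p+1}}{r^p}\|H\|_1|||H|||_1^{p}\bigr)$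 (exact supports are not needed). 5. If $\|H_{\vec j}\|\le1$ for all $\vec j$, then $\|H\|_1\le n^k$, $\tfrac1{\sqrt d}\|H\|_{1,F}\le n^k$, $|||H|||_{\mathrm{per}}=\mathcal O(n^{(k-1)/2})$ and $|||H|||_1=\mathcal O(n^{k-1})$. Hence $W_1=\mathcal O(t^2n^{2k-1}/r)$ and $W_2=\mathcal O(t^3n^{3k-2}/r^2)$, whereas, if moreover $H$ has exact supports, $R_1=\mathcal O(t^2n^{(3k-1)/2}/r)$ and $R_2=\mathcal O(t^3n^{(5k-3)/2}/r^2)$. -/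

import Mathlib

open scoped BigOperators Matrix
open MeasureTheory

noncomputable section

/-- Operators on `n` qubits, as matrices in the computational basis `{0,1}^n`. -/
abbrev QOp (n : ℕ) : Type := Matrix (Fin n → Fin 2) (Fin n → Fin 2) ℂ

/-- The Hilbert space of `n` qubits, of dimension `2 ^ n`. -/
abbrev QState (n : ℕ) : Type := EuclideanSpace ℂ (Fin n → Fin 2)

/-- The Pauli matrices `I, X, Y, Z`. -/
def pauliMatrix : Fin 4 → Matrix (Fin 2) (Fin 2) ℂ :=
  ![1, !![0, 1; 1, 0], !![0, -Complex.I; Complex.I, 0], !![1, 0; 0, -1]]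

/-- The Pauli string that applies `pauliMatrix (P q)` to the qubit `q`, for every `q`. -/
def pauliString {n : ℕ} (P : Fin n → Fin 4) : QOp n :=
  Matrix.of fun x y => ∏ q, pauliMatrix (P q) (x q) (y q)

/-- The qubits at which a Pauli string is not the identity. -/
def pauliSupport {n : ℕ} (P : Fin n → Fin 4) : Finset (Fin n) :=
  Finset.univ.filter fun q => P q ≠ 0

/-- `A` acts as the identity outside `S`: its expansion contains only Pauli strings whose support
is contained in `S`. -/
def ActsWithin {n : ℕ} (S : Finset (Fin n)) (A : QOp n) : Prop :=
  A ∈ Submodule.span ℂ {B : QOp n | ∃ P : Fin n → Fin 4, pauliSupport P ⊆ S ∧ B = pauliString P}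

/-- The expansion of `A` contains only Pauli strings whose support is exactly `S`. -/
def ActsExactlyOn {n : ℕ} (S : Finset (Fin n)) (A : QOp n) : Prop :=
  A ∈ Submodule.span ℂ {B : QOp n | ∃ P : Fin n → Fin 4, pauliSupport P = S ∧ B = pauliString P}

/-- Spectral (operator) norm. -/
def opNorm {n : ℕ} (A : QOp n) : ℝ :=
  ‖Matrix.toEuclideanCLM (n := Fin n → Fin 2) (𝕜 := ℂ) A‖

/-- Frobenius norm `√(Tr (A A†))`. -/
def frobNorm {n : ℕ} (A : QOp n) : ℝ :=
  Real.sqrt (Matrix.trace (A * Aᴴ)).re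

/-- The set of qubits `{j₁, …, jₖ}` of a tuple. -/
def tupleSet {n k : ℕ} (j : Fin k → Fin n) : Finset (Fin n) := Finset.univ.image j

/-- A `k`-local Hamiltonian `H = ∑ H_{j₁,…,jₖ}` on `n` qubits, given by its terms, where
`H_{j₁,…,jₖ}` acts only on the qubits `j₁, …, jₖ`. -/
structure KLocalHamiltonian (n k : ℕ) where
  term : (Fin k → Fin n) → QOp n
  hermitian : ∀ j, (term j).IsHermitian
  actsWithin : ∀ j, ActsWithin (tupleSet j) (term j)

namespace KLocalHamiltonian

variable {n k : ℕ}

/-- Every term acts nontrivially on all of its qubits, in the sense that it is a linear combination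
of Pauli strings whose support is exactly `{j₁, …, jₖ}`. -/
def ExactSupport (H : KLocalHamiltonian n k) : Prop :=
  ∀ j, ActsExactlyOn (tupleSet j) (H.term j)

/-- The Hamiltonian itself. -/
def total (H : KLocalHamiltonian n k) : QOp n := ∑ j, H.term j

/-- `‖H‖₁ = ∑ ‖H_j‖`. -/
def oneNorm (H : KLocalHamiltonian n k) : ℝ := ∑ j, opNorm (H.term j)

/-- `‖H‖_{1,F} = ∑ ‖H_j‖_F`. -/
def oneFrobNorm (H : KLocalHamiltonian n k) : ℝ := ∑ j, frobNorm (H.term j)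

/-- The induced one-norm: the maximum over a position `l` and a qubit `q` of the sum of `‖H_j‖`
over the tuples `j` with `j_l = q`. -/
def inducedOneNorm (H : KLocalHamiltonian n k) : ℝ :=
  ⨆ x : Fin k × Fin n, ∑ j with j x.1 = x.2, opNorm (H.term j)

/-- `j ∖ l` up to reordering: two tuples with an entry deleted from each are permutations of one
another if and only if these multisets agree. -/
def rest (l : Fin k) (j : Fin k → Fin n) : Multiset (Fin n) :=
  (Finset.univ.erase l).val.map j

/-- The square of the induced permutation norm,
`max_{l, j_l} ∑_{j ∖ l} ‖H_j‖ (max_{l', j'_{l'}} ∑_{j' ∖ l' = π (j ∖ l)} ‖H_{j'}‖)`. -/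
def permNormSq (H : KLocalHamiltonian n k) : ℝ :=
  ⨆ x : Fin k × Fin n, ∑ j with j x.1 = x.2,
    opNorm (H.term j) *
      ⨆ y : Fin k × Fin n, ∑ j' with j' y.1 = y.2 ∧ rest y.1 j' = rest x.1 j, opNorm (H.term j')

/-- The induced permutation norm. -/
def permNorm (H : KLocalHamiltonian n k) : ℝ := Real.sqrt H.permNormSq

end KLocalHamiltonian

/-- The evolution `exp (-i t A)`. -/
def evolution {n : ℕ} (A : QOp n) (t : ℝ) : QOp n :=
  NormedSpace.exp ((-(Complex.I * (t : ℂ))) • A)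

/-- First-order product formula `e^{-iH₁t} ⋯ e^{-iH_Lt}`. -/
def pf1 {n L : ℕ} (A : Fin L → QOp n) (t : ℝ) : QOp n :=
  (List.ofFn fun l => evolution (A l) t).prod

/-- Second-order product formula: increasing order for time `t/2`, then decreasing order. -/
def pf2 {n L : ℕ} (A : Fin L → QOp n) (t : ℝ) : QOp n :=
  (List.ofFn fun l => evolution (A l) (t / 2)).prod *
    (List.ofFn fun l => evolution (A l) (t / 2)).reverse.prod

/-- Suzuki's product formula of order `2q`, for `q ≥ 1` (the value at `q = 0` is a dummy):
`U_{2q}(t) = U_{2q-2}(p t)² U_{2q-2}((1-4p)t) U_{2q-2}(p t)²` with `p = 1/(4 - 4^{1/(2q-1)})`. -/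
def suzuki {n L : ℕ} (A : Fin L → QOp n) : ℕ → ℝ → QOp n
  | 0, _ => 1
  | 1, t => pf2 A t
  | (m + 2), t =>
      let p : ℝ := 1 / (4 - (4 : ℝ) ^ ((1 : ℝ) / (2 * ((m : ℝ) + 2) - 1)))
      (suzuki A (m + 1) (p * t)) ^ 2 * suzuki A (m + 1) ((1 - 4 * p) * t) *
        (suzuki A (m + 1) (p * t)) ^ 2

/-- A 1-design: a probability distribution (discrete or not) on unit vectors `ψ` with
`E |ψ⟩⟨ψ| = I / d`, where `d = 2 ^ n`; `I / d` is also the value for Haar-random `ψ`. -/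
structure IsOneDesign {n : ℕ} (μ : Measure (QState n)) : Prop where
  isProbabilityMeasure : IsProbabilityMeasure μ
  unit : ∀ᵐ ψ ∂μ, ‖ψ‖ = 1
  moment : ∀ x y : Fin n → Fin 2,
    ∫ ψ, ψ x * (starRingEnd ℂ) (ψ y) ∂μ = if x = y then 1 / (2 : ℂ) ^ n else 0

/-- Average `ℓ₂` error `E ‖Uψ - U₀ψ‖` over the ensemble `μ`. -/
def avgError {n : ℕ} (μ : Measure (QState n)) (U U₀ : QOp n) : ℝ :=
  ∫ ψ, ‖Matrix.toEuclideanCLM (n := Fin n → Fin 2) (𝕜 := ℂ) U ψ -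
    Matrix.toEuclideanCLM (n := Fin n → Fin 2) (𝕜 := ℂ) U₀ ψ‖ ∂μ

/-- Worst-case error `‖U - U₀‖` in the spectral norm. -/
def worstError {n : ℕ} (U U₀ : QOp n) : ℝ := opNorm (U - U₀)

end

/-! A product S(t) of exponentials solves S' = -iGS, where G is the sum of the exponents, each
conjugated by the exponentials to its left. In the interaction picture, S(t) - e^{-iHt} is
controlled by the integral of ‖G - H‖. Taylor expansion of the conjugations, innermost first, turns
G into a polynomial of degree < p in t, with nested commutators as coefficients, plus a remainder.
Every conjugation left in the remainder is outermost, hence invisible to a norm that does not grow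
under multiplication by unitaries, so the remainder is bounded by bare nested commutators of depth
p. If the formula has order p, the polynomial must equal H and only the remainder survives
(`IsIdealNorm.prodEvo_sub_evo_le`). The argument runs once for the spectral and the Frobenius norm;
averaging over a 1-design reduces to the Frobenius norm divided by √d (`avgError_le`).

That Suzuki's formulas have order 2q follows from the leading error coefficients: they add under
products, scale by a power under t ↦ ct, and vanish at even powers of t for time-symmetric formulas.

Locality bounds the nested commutators: at depth m they live on at most (m+1)k qubits, so the terms
that fail to commute with one of them have total norm O(|||H|||₁), and each commutator costs one
such factor (`IsIdealNorm.nestedSum_le`). This gives the worst-case bounds and the average bounds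
for p > 2.

The gain for p = 1, 2 comes from not splitting the sum in [H_i, ∑ H_j]. With exact supports,
commutators whose H_j cover different qubits outside supp H_i are combinations of different Pauli
strings, hence Hilbert-Schmidt orthogonal: their squares add, and |||H|||_per replaces |||H|||₁
(`frobNorm_lie_sum_sq_le`). To meet such undivided commutators, the terms are peeled off one at a
time, comparing at each stage a formula for the two exponents H_i and B, the sum of the terms not
yet peeled. -/

noncomputable section

namespace ProductFormula

/-! ### One-parameter groups and ideal norms in a C⋆-algebra -/

section Generic

variable {𝓐 : Type*} [CStarAlgebra 𝓐] {V : Type*} [NormedAddCommGroup V] [NormedSpace ℂ V]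

/-- The evolution `exp (-i t A)` in a C⋆-algebra. -/
def evo (A : 𝓐) (t : ℝ) : 𝓐 := NormedSpace.exp ((-(Complex.I * (t : ℂ))) • A)

lemma evo_eq (A : 𝓐) (t : ℝ) : evo A t = NormedSpace.exp (t • ((-Complex.I) • A)) := by
  rw [evo, ← Complex.coe_smul, smul_smul]
  congr 2
  ring

@[simp] lemma evo_zero_time (A : 𝓐) : evo A 0 = 1 := by simp [evo]

@[simp] lemma evo_zero (t : ℝ) : evo (0 : 𝓐) t = 1 := by simp [evo]

lemma evo_add (A : 𝓐) (s t : ℝ) : evo A (s + t) = evo A s * evo A t := by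
  let : NormedAlgebra ℚ 𝓐 := NormedAlgebra.restrictScalars ℚ ℂ 𝓐
  rw [evo_eq, evo_eq, evo_eq, add_smul, NormedSpace.exp_add_of_commute]
  exact ((Commute.refl _).smul_left _).smul_right _

@[simp] lemma evo_mul_neg (A : 𝓐) (t : ℝ) : evo A t * evo A (-t) = 1 := by
  rw [← evo_add]; simp

@[simp] lemma evo_neg_mul (A : 𝓐) (t : ℝ) : evo A (-t) * evo A t = 1 := by
  rw [← evo_add]; simp

lemma evo_smul (A : 𝓐) (c t : ℝ) : evo (c • A) t = evo A (c * t) := by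
  rw [evo_eq, evo_eq, smul_comm _ c A, smul_smul, mul_comm]

lemma evo_nsmul (A : 𝓐) (t : ℝ) (r : ℕ) : evo A t ^ r = evo A (r * t) := by
  induction r with
  | zero => simp
  | succ r ih => rw [pow_succ, ih, ← evo_add]; push_cast; ring_nf

lemma hasDerivAt_evo (A : 𝓐) (t : ℝ) :
    HasDerivAt (evo A) (-Complex.I • (A * evo A t)) t := by
  have h := hasDerivAt_exp_smul_const' (𝕂 := ℝ) ((-Complex.I) • A) t
  have h2 : evo A = fun u : ℝ => NormedSpace.exp (u • ((-Complex.I) • A)) := funext (evo_eq A)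
  rw [h2]
  simpa using h

lemma commute_evo {A B : 𝓐} (h : Commute A B) (t : ℝ) : Commute A (evo B t) := by
  exact (h.smul_right _).exp_right

lemma hasDerivAt_evo_neg (A : 𝓐) (t : ℝ) :
    HasDerivAt (fun s => evo A (-s)) (Complex.I • (evo A (-t) * A)) t := by
  have h := (hasDerivAt_evo A (-t)).scomp t (hasDerivAt_neg t)
  rw [← (commute_evo (Commute.refl A) (-t)).eq]
  exact h.congr_deriv (by simp)

lemma analyticAt_evo (A : 𝓐) (t : ℝ) : AnalyticAt ℝ (evo A) t := by
  have h2 : evo A = fun u : ℝ => NormedSpace.exp (u • ((-Complex.I) • A)) := funext (evo_eq A)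
  rw [h2]
  exact (NormedSpace.exp_analytic _).comp (analyticAt_id.smul analyticAt_const)

lemma evo_mem_unitary {A : 𝓐} (hA : IsSelfAdjoint A) (t : ℝ) : evo A t ∈ unitary 𝓐 := by
  let : NormedAlgebra ℚ 𝓐 := NormedAlgebra.restrictScalars ℚ ℂ 𝓐
  apply NormedSpace.exp_mem_unitary_of_mem_skewAdjoint
  rw [skewAdjoint.mem_iff, star_smul, hA.star_eq]
  simp

lemma norm_le_one_of_mem_unitary {U : 𝓐} (hU : U ∈ unitary 𝓐) : ‖U‖ ≤ 1 := by
  rcases subsingleton_or_nontrivial 𝓐 with h | h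
  · rw [Subsingleton.elim U 0]; simp
  · exact (CStarRing.norm_of_mem_unitary hU).le

/-- The seminorm `x ↦ ‖ι x‖` is compatible with multiplication on both sides. -/
structure IsIdealNorm (ι : 𝓐 →L[ℂ] V) : Prop where
  mul_left : ∀ a x, ‖ι (a * x)‖ ≤ ‖a‖ * ‖ι x‖
  mul_right : ∀ a x, ‖ι (x * a)‖ ≤ ‖ι x‖ * ‖a‖

lemma isIdealNorm_id : IsIdealNorm (ContinuousLinearMap.id ℂ 𝓐) :=
  ⟨fun a x => norm_mul_le a x, fun a x => norm_mul_le x a⟩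

namespace IsIdealNorm

variable {ι : 𝓐 →L[ℂ] V}

lemma unitary_mul (hι : IsIdealNorm ι) {U : 𝓐} (hU : U ∈ unitary 𝓐) (x : 𝓐) :
    ‖ι (U * x)‖ ≤ ‖ι x‖ :=
  (hι.mul_left U x).trans
    (mul_le_of_le_one_left (norm_nonneg _) (norm_le_one_of_mem_unitary hU))

lemma mul_unitary (hι : IsIdealNorm ι) {U : 𝓐} (hU : U ∈ unitary 𝓐) (x : 𝓐) :
    ‖ι (x * U)‖ ≤ ‖ι x‖ :=
  (hι.mul_right U x).trans
    (mul_le_of_le_one_right (norm_nonneg _) (norm_le_one_of_mem_unitary hU))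

lemma lie_le (hι : IsIdealNorm ι) (a x : 𝓐) : ‖ι ⁅a, x⁆‖ ≤ 2 * ‖a‖ * ‖ι x‖ := by
  rw [Ring.lie_def, map_sub]
  have := hι.mul_left a x
  have := hι.mul_right a x
  have := norm_sub_le (ι (a * x)) (ι (x * a))
  linarith

lemma lie_le' (hι : IsIdealNorm ι) (a x : 𝓐) : ‖ι ⁅x, a⁆‖ ≤ 2 * ‖a‖ * ‖ι x‖ := by
  rw [← norm_neg, ← map_neg, show -⁅x, a⁆ = ⁅a, x⁆ by rw [Ring.lie_def, Ring.lie_def, neg_sub]]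
  exact hι.lie_le a x

/-- The error of a power is at most the number of factors times the error of one factor. -/
lemma pow_sub_pow_le (hι : IsIdealNorm ι) {U W : 𝓐} (hU : U ∈ unitary 𝓐) (hW : W ∈ unitary 𝓐)
    (r : ℕ) : ‖ι (U ^ r - W ^ r)‖ ≤ r * ‖ι (U - W)‖ := by
  induction r with
  | zero => simp
  | succ r ih =>
    have h : U ^ (r + 1) - W ^ (r + 1) = U * (U ^ r - W ^ r) + (U - W) * W ^ r := by
      rw [pow_succ', pow_succ']; noncomm_ring
    rw [h, map_add]
    refine (norm_add_le _ _).trans ?_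
    have h1 := hι.unitary_mul hU (U ^ r - W ^ r)
    have h2 := hι.mul_unitary (pow_mem hW r) (U - W)
    push_cast
    linarith

end IsIdealNorm

/-! ### Conjugation by a one-parameter group and its Taylor expansion -/

/-- `-i [X, ·]`. -/
def derivation (X : 𝓐) : 𝓐 →ₗ[ℂ] 𝓐 :=
  (-Complex.I) • (LinearMap.mulLeft ℂ X - LinearMap.mulRight ℂ X)

lemma derivation_apply (X x : 𝓐) : derivation X x = -Complex.I • ⁅X, x⁆ := by
  simp [derivation, Ring.lie_def]

/-- `e^{-iXτ} x e^{iXτ}`. -/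
def conjEvo (X : 𝓐) (τ : ℝ) (x : 𝓐) : 𝓐 := evo X τ * x * evo X (-τ)

lemma hasDerivAt_conjEvo (X x : 𝓐) (τ : ℝ) :
    HasDerivAt (fun s => conjEvo X s x) (conjEvo X τ (derivation X x)) τ := by
  have h := ((hasDerivAt_evo X τ).mul_const x).mul (hasDerivAt_evo_neg X τ)
  refine h.congr_deriv ?_
  rw [conjEvo, derivation_apply, Ring.lie_def, (commute_evo (Commute.refl X) τ).eq,
    ← (commute_evo (Commute.refl X) (-τ)).eq]
  simp only [smul_mul_assoc, mul_smul_comm, mul_sub, sub_mul, smul_sub, mul_assoc, neg_smul,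
    neg_mul, mul_neg]
  abel

lemma IsIdealNorm.conjEvo_le {ι : 𝓐 →L[ℂ] V} (hι : IsIdealNorm ι) {X : 𝓐}
    (hX : IsSelfAdjoint X) (τ : ℝ) (x : 𝓐) : ‖ι (conjEvo X τ x)‖ ≤ ‖ι x‖ :=
  (hι.mul_unitary (evo_mem_unitary hX _) _).trans (hι.unitary_mul (evo_mem_unitary hX _) _)

lemma conjEvo_add (X : 𝓐) (τ : ℝ) (x y : 𝓐) :
    conjEvo X τ (x + y) = conjEvo X τ x + conjEvo X τ y := by
  simp [conjEvo, mul_add, add_mul]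

lemma conjEvo_smul (X : 𝓐) (τ c : ℝ) (x : 𝓐) :
    conjEvo X τ (c • x) = c • conjEvo X τ x := by
  simp [conjEvo]

lemma conjEvo_sum {α : Type*} (X : 𝓐) (τ : ℝ) (s : Finset α) (f : α → 𝓐) :
    conjEvo X τ (∑ a ∈ s, f a) = ∑ a ∈ s, conjEvo X τ (f a) := by
  simp [conjEvo, Finset.mul_sum, Finset.sum_mul]

/-- `(T_X)^j x / j!`, a Taylor coefficient of `e^{-iXτ} x e^{iXτ}`. -/
def taylorTerm (X : 𝓐) (j : ℕ) : 𝓐 →ₗ[ℂ] 𝓐 := ((j.factorial : ℂ)⁻¹) • (derivation X) ^ j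

lemma taylorTerm_zero (X x : 𝓐) : taylorTerm X 0 x = x := by simp [taylorTerm]

/-- Hence the Taylor polynomial of `conjEvo X · x` has as derivative the polynomial of one degree
less for `derivation X x`, which drives the induction in `IsIdealNorm.conjEvo_taylor`. -/
lemma taylorTerm_succ (X x : 𝓐) (j : ℕ) :
    taylorTerm X j (derivation X x) = ((j + 1 : ℕ) : ℝ) • taylorTerm X (j + 1) x := by
  rw [← Complex.coe_smul]
  simp only [taylorTerm, LinearMap.smul_apply, pow_succ, Module.End.mul_apply, smul_smul]
  congr 1
  rw [Nat.factorial_succ]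
  have h1 : (j.factorial : ℂ) ≠ 0 := by exact_mod_cast j.factorial_ne_zero
  have h2 : ((j : ℂ) + 1) ≠ 0 := by exact_mod_cast j.succ_ne_zero
  push_cast
  field_simp

/-- If a curve starts at zero with velocity at most `C (j+1) s^j`, then it is at most `C t^(j+1)`. -/
lemma norm_le_pow_of_deriv {E : Type*} [NormedAddCommGroup E] [NormedSpace ℝ E] {f f' : ℝ → E}
    (hf : ∀ t, HasDerivAt f (f' t) t) (h0 : f 0 = 0) {C : ℝ} {j : ℕ}
    (hb : ∀ t, 0 ≤ t → ‖f' t‖ ≤ C * ((j + 1 : ℕ) * t ^ j)) {t : ℝ} (ht : 0 ≤ t) :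
    ‖f t‖ ≤ C * t ^ (j + 1) := by
  have hB : ∀ x : ℝ, HasDerivAt (fun t : ℝ => C * t ^ (j + 1)) (C * ((j + 1 : ℕ) * x ^ j)) x := by
    intro x
    simpa using (hasDerivAt_pow (j + 1) x).const_mul C
  exact image_norm_le_of_norm_deriv_right_le_deriv_boundary (a := 0) (b := t)
    (fun x _ => (hf x).continuousAt.continuousWithinAt)
    (fun x _ => (hf x).hasDerivWithinAt) (by simp [h0]) hB
    (fun x hx => hb x hx.1) ⟨ht, le_rfl⟩

/-- Taylor's theorem for a conjugation by a one-parameter group, with the remainder controlled by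
the first omitted nested commutator. -/
lemma IsIdealNorm.conjEvo_taylor {ι : 𝓐 →L[ℂ] V} (hι : IsIdealNorm ι) {X : 𝓐}
    (hX : IsSelfAdjoint X) (J : ℕ) (x : 𝓐) {τ : ℝ} (hτ : 0 ≤ τ) :
    ‖ι (conjEvo X τ x - ∑ j ∈ Finset.range J, τ ^ j • taylorTerm X j x)‖
      ≤ ‖ι (taylorTerm X J x)‖ * τ ^ J := by
  induction J generalizing x τ with
  | zero => simpa [taylorTerm_zero] using hι.conjEvo_le hX τ x
  | succ J ih =>
    -- The error of order J + 1 at `x` has as derivative the error of order J at `derivation X x`;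
    -- this is why `x` is generalized. The factor J + 1 from `taylorTerm_succ` is absorbed exactly
    -- by the integration.
    have hd : ∀ t : ℝ, HasDerivAt
        (fun t : ℝ => ι (conjEvo X t x - ∑ j ∈ Finset.range (J + 1), t ^ j • taylorTerm X j x))
        (ι (conjEvo X t (derivation X x) -
          ∑ j ∈ Finset.range J, t ^ j • taylorTerm X j (derivation X x))) t := by
      intro t
      have h1 : HasDerivAt (fun t : ℝ => ∑ j ∈ Finset.range (J + 1), t ^ j • taylorTerm X j x)
          (∑ j ∈ Finset.range J, t ^ j • taylorTerm X j (derivation X x)) t := by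
        have h2 : HasDerivAt (fun t : ℝ => ∑ j ∈ Finset.range (J + 1), t ^ j • taylorTerm X j x)
            (∑ j ∈ Finset.range (J + 1), ((j : ℝ) * t ^ (j - 1)) • taylorTerm X j x) t :=
          HasDerivAt.fun_sum fun j _ => (hasDerivAt_pow j t).smul_const _
        refine h2.congr_deriv ?_
        rw [Finset.sum_range_succ']
        simp only [CharP.cast_eq_zero, zero_mul, zero_smul, add_zero, taylorTerm_succ, smul_smul,
          Nat.add_sub_cancel]
        exact Finset.sum_congr rfl fun j _ => by rw [mul_comm]
      exact (ι.restrictScalars ℝ).hasFDerivAt.comp_hasDerivAt t ((hasDerivAt_conjEvo X x t).sub h1)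
    refine norm_le_pow_of_deriv hd ?_ (fun t ht => (ih (derivation X x) ht).trans ?_) hτ
    · simp [Finset.sum_range_succ', conjEvo, taylorTerm_zero]
    · rw [taylorTerm_succ, ← Complex.coe_smul, map_smul, norm_smul]
      simp only [Complex.norm_real, Real.norm_natCast]
      exact le_of_eq (by ring)

/-! ### Products of exponentials and the expansion of their generators -/

/-- The product `e^{-iX₁t} ⋯ e^{-iX_Mt}`. -/
def prodEvo (σ : List 𝓐) (t : ℝ) : 𝓐 := (σ.map fun X => evo X t).prod

@[simp] lemma prodEvo_nil (t : ℝ) : prodEvo ([] : List 𝓐) t = 1 := rfl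

@[simp] lemma prodEvo_cons (X : 𝓐) (σ : List 𝓐) (t : ℝ) :
    prodEvo (X :: σ) t = evo X t * prodEvo σ t := by simp [prodEvo]

lemma prodEvo_append (σ σ' : List 𝓐) (t : ℝ) :
    prodEvo (σ ++ σ') t = prodEvo σ t * prodEvo σ' t := by simp [prodEvo]

lemma prodEvo_smul (σ : List 𝓐) (c t : ℝ) :
    prodEvo (σ.map fun X => c • X) t = prodEvo σ (c * t) := by
  simp [prodEvo, Function.comp_def, evo_smul]

lemma prodEvo_mem_unitary {σ : List 𝓐} (hσ : ∀ X ∈ σ, IsSelfAdjoint X) (t : ℝ) :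
    prodEvo σ t ∈ unitary 𝓐 := by
  refine list_prod_mem fun x hx => ?_
  obtain ⟨X, hX, rfl⟩ := List.mem_map.1 hx
  exact evo_mem_unitary (hσ X hX) t

lemma analyticAt_prodEvo (σ : List 𝓐) (t : ℝ) : AnalyticAt ℝ (prodEvo σ) t := by
  induction σ with
  | nil => exact analyticAt_const
  | cons X σ ih =>
    have : prodEvo (X :: σ) = fun t => evo X t * prodEvo σ t := funext (prodEvo_cons X σ)
    rw [this]
    exact (analyticAt_evo X t).mul ih

/-- The generator of a product: `S' = -i G S`. -/
def generator : List 𝓐 → ℝ → 𝓐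
  | [], _ => 0
  | X :: σ, τ => X + conjEvo X τ (generator σ τ)

lemma hasDerivAt_prodEvo (σ : List 𝓐) (t : ℝ) :
    HasDerivAt (prodEvo σ) (-Complex.I • (generator σ t * prodEvo σ t)) t := by
  induction σ with
  | nil => exact (hasDerivAt_const t (1 : 𝓐)).congr_deriv (by simp [generator])
  | cons X σ ih =>
    have : prodEvo (X :: σ) = fun t => evo X t * prodEvo σ t := funext (prodEvo_cons X σ)
    rw [this]
    refine ((hasDerivAt_evo X t).mul ih).congr_deriv ?_
    simp only [generator, conjEvo, smul_mul_assoc, mul_smul_comm, ← smul_add, add_mul, mul_assoc]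
    congr 3
    rw [← mul_assoc (evo X (-t)), evo_neg_mul, one_mul]

/-- The sum of `φ` over the nested commutators of depth `m` in the generator of a product. -/
def nestedSum {M : Type*} [AddCommMonoid M] : List 𝓐 → ℕ → (𝓐 → M) → M
  | [], _, _ => 0
  | X :: σ, m, φ => (if m = 0 then φ X else 0) +
      ∑ j ∈ Finset.range (m + 1), nestedSum σ (m - j) (fun x => φ (taylorTerm X j x))

/-- The same recursion with values in `𝓐` yields the Taylor coefficients and, with values in ℝ, the
error bound; additive maps are what relates the two. -/
lemma map_nestedSum {M N : Type*} [AddCommMonoid M] [AddCommMonoid N] (f : M →+ N)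
    (σ : List 𝓐) (m : ℕ) (φ : 𝓐 → M) : f (nestedSum σ m φ) = nestedSum σ m (fun x => f (φ x)) := by
  induction σ generalizing m φ with
  | nil => simp [nestedSum]
  | cons X σ ih =>
    simp only [nestedSum, map_add, map_sum, ih]
    split_ifs <;> simp

lemma norm_nestedSum_le {E : Type*} [SeminormedAddCommGroup E] (σ : List 𝓐) (m : ℕ) (φ : 𝓐 → E) :
    ‖nestedSum σ m φ‖ ≤ nestedSum σ m (fun x => ‖φ x‖) := by
  induction σ generalizing m φ with
  | nil => simp [nestedSum]
  | cons X σ ih =>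
    simp only [nestedSum]
    refine (norm_add_le _ _).trans (add_le_add ?_ ?_)
    · split_ifs <;> simp
    · exact (norm_sum_le _ _).trans (Finset.sum_le_sum fun j _ => ih _ _)

/-- The Taylor coefficients of the generator. -/
def generatorCoeff (σ : List 𝓐) (m : ℕ) : 𝓐 := nestedSum σ m id

lemma map_generatorCoeff {N : Type*} [AddCommMonoid N] (f : 𝓐 →+ N) (σ : List 𝓐) (m : ℕ) :
    f (generatorCoeff σ m) = nestedSum σ m f := map_nestedSum f σ m id

lemma generatorCoeff_cons (X : 𝓐) (σ : List 𝓐) (m : ℕ) :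
    generatorCoeff (X :: σ) m = (if m = 0 then X else 0) +
      ∑ j ∈ Finset.range (m + 1), taylorTerm X j (generatorCoeff σ (m - j)) := by
  have h : ∀ j, nestedSum σ (m - j) (fun x => id (taylorTerm X j x)) =
      taylorTerm X j (generatorCoeff σ (m - j)) := fun j =>
    (map_generatorCoeff (taylorTerm X j : 𝓐 →ₗ[ℂ] 𝓐).toAddMonoidHom σ (m - j)).symm
  rw [generatorCoeff, nestedSum]
  exact congrArg₂ (· + ·) rfl (Finset.sum_congr rfl fun j _ => h j)

/-- Taylor's theorem for the generator; no commutator in the remainder is conjugated inside. -/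
lemma IsIdealNorm.generator_taylor {ι : 𝓐 →L[ℂ] V} (hι : IsIdealNorm ι) {σ : List 𝓐}
    (hσ : ∀ X ∈ σ, IsSelfAdjoint X) {p : ℕ} (hp : 1 ≤ p) {τ : ℝ} (hτ : 0 ≤ τ) :
    ‖ι (generator σ τ - ∑ m ∈ Finset.range p, τ ^ m • generatorCoeff σ m)‖
      ≤ τ ^ p * nestedSum σ p (fun x => ‖ι x‖) := by
  induction σ with
  | nil => simp [generator, generatorCoeff, nestedSum]
  | cons X σ ih =>
    have hX : IsSelfAdjoint X := hσ X (by simp)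
    specialize ih fun Y hY => hσ Y (by simp [hY])
    have hsum : ∑ m ∈ Finset.range p, τ ^ m • generatorCoeff (X :: σ) m =
        X + ∑ m ∈ Finset.range p, τ ^ m • ∑ j ∈ Finset.range (p - m),
          τ ^ j • taylorTerm X j (generatorCoeff σ m) := by
      have h1 : ∑ m ∈ Finset.range p, τ ^ m • (if m = 0 then X else 0) = X := by
        rw [Finset.sum_eq_single_of_mem 0 (Finset.mem_range.2 hp)]
        · simp
        · intro m _ hm; simp [hm]
      have h2 := Finset.sum_range_diag_flip p
        (fun j m => τ ^ (m + j) • taylorTerm X j (generatorCoeff σ m))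
      have h3 : ∑ m ∈ Finset.range p, ∑ j ∈ Finset.range (p - m),
          τ ^ (m + j) • taylorTerm X j (generatorCoeff σ m) =
          ∑ m ∈ Finset.range p, ∑ j ∈ Finset.range (p - m),
            τ ^ (j + m) • taylorTerm X m (generatorCoeff σ j) := by
        rw [← Finset.sum_range_diag_flip, ← Finset.sum_range_diag_flip]
        refine Finset.sum_congr rfl fun m _ => ?_
        rw [← Finset.sum_range_reflect]
        refine Finset.sum_congr rfl fun j hj => ?_
        have : j ≤ m := by simpa [Nat.lt_succ_iff] using hj
        have e1 : m + 1 - 1 - j = m - j := by omega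
        have e2 : m - (m - j) = j := by omega
        rw [e1, e2]
      simp only [generatorCoeff_cons, smul_add, Finset.sum_add_distrib, h1]
      congr 1
      simp only [Finset.smul_sum, smul_smul, ← pow_add]
      rw [h3, ← h2]
      refine Finset.sum_congr rfl fun m _ => Finset.sum_congr rfl fun j hj => ?_
      have : j ≤ m := by simpa [Nat.lt_succ_iff] using hj
      rw [Nat.sub_add_cancel this]
    -- The remainder of the tail is conjugated as a whole, which does not increase an ideal norm.
    -- The coefficient of degree m already carries τ^m, so its conjugation need only be expanded to
    -- order p - m.
    have hdecomp : generator (X :: σ) τ - ∑ m ∈ Finset.range p, τ ^ m • generatorCoeff (X :: σ) m =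
        conjEvo X τ (generator σ τ - ∑ m ∈ Finset.range p, τ ^ m • generatorCoeff σ m) +
        ∑ m ∈ Finset.range p, τ ^ m • (conjEvo X τ (generatorCoeff σ m) -
          ∑ j ∈ Finset.range (p - m), τ ^ j • taylorTerm X j (generatorCoeff σ m)) := by
      have h1 := conjEvo_add X τ
        (generator σ τ - ∑ m ∈ Finset.range p, τ ^ m • generatorCoeff σ m)
        (∑ m ∈ Finset.range p, τ ^ m • generatorCoeff σ m)
      rw [sub_add_cancel, conjEvo_sum] at h1
      simp only [conjEvo_smul] at h1
      rw [hsum, generator, h1]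
      simp only [smul_sub, Finset.sum_sub_distrib]
      abel
    -- The sum splits to match the decomposition: j = 0 pays for the remainder of the tail, and j =
    -- p - m > 0 for the expansion of the coefficient of degree m.
    have hW : nestedSum (X :: σ) p (fun x => ‖ι x‖) = nestedSum σ p (fun x => ‖ι x‖) +
        ∑ m ∈ Finset.range p, nestedSum σ m (fun x => ‖ι (taylorTerm X (p - m) x)‖) := by
      rw [nestedSum, if_neg (by omega), zero_add, Finset.sum_range_succ', add_comm]
      congr 1
      · simp [taylorTerm_zero]
      · rw [← Finset.sum_range_reflect]
        refine Finset.sum_congr rfl fun j hj => ?_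
        have : j < p := by simpa using hj
        have e1 : p - (p - 1 - j + 1) = j := by omega
        have e2 : p - 1 - j + 1 = p - j := by omega
        rw [e1, e2]
    rw [hdecomp, hW, map_add, mul_add]
    refine (norm_add_le _ _).trans (add_le_add ((hι.conjEvo_le hX _ _).trans ih) ?_)
    rw [map_sum, Finset.mul_sum]
    refine (norm_sum_le _ _).trans (Finset.sum_le_sum fun m hm => ?_)
    have hm' : m < p := by simpa using hm
    rw [← Complex.coe_smul, map_smul, norm_smul, Complex.norm_real, Real.norm_of_nonneg (by positivity)]
    have h1 := hι.conjEvo_taylor hX (p - m) (generatorCoeff σ m) hτ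
    have h2 : ‖ι (taylorTerm X (p - m) (generatorCoeff σ m))‖ ≤
        nestedSum σ m (fun x => ‖ι (taylorTerm X (p - m) x)‖) := by
      rw [show ι (taylorTerm X (p - m) (generatorCoeff σ m)) =
        nestedSum σ m (fun x => ι (taylorTerm X (p - m) x)) from
        map_generatorCoeff ((ι : 𝓐 →ₗ[ℂ] V) ∘ₗ taylorTerm X (p - m)).toAddMonoidHom σ m]
      exact norm_nestedSum_le _ _ _
    calc τ ^ m * _ ≤ τ ^ m * (nestedSum σ m (fun x => ‖ι (taylorTerm X (p - m) x)‖) * τ ^ (p - m)) := by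
          gcongr
          exact h1.trans (by gcongr)
      _ = τ ^ p * _ := by
          rw [mul_comm _ (τ ^ (p - m)), ← mul_assoc, ← pow_add, Nat.add_sub_cancel' hm'.le]

/-! ### Order conditions and the commutator bound on the error -/

/-- A polynomial of degree less than `p` that is `O(t^p)` vanishes. -/
lemma sum_pow_smul_eq_zero {E : Type*} [NormedAddCommGroup E] [NormedSpace ℝ E] (p : ℕ)
    (d : ℕ → E)
    (h : (fun t : ℝ => ∑ m ∈ Finset.range p, t ^ m • d m) =O[nhdsWithin 0 (Set.Ioi 0)]
      (fun t : ℝ => t ^ p)) :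
    ∀ m < p, d m = 0 := by
  induction p generalizing d with
  | zero => intro m hm; omega
  | succ p ih =>
    have hc : Filter.Tendsto (fun t : ℝ => ∑ m ∈ Finset.range (p + 1), t ^ m • d m)
        (nhdsWithin 0 (Set.Ioi 0)) (nhds (d 0)) := by
      have : Continuous (fun t : ℝ => ∑ m ∈ Finset.range (p + 1), t ^ m • d m) := by fun_prop
      have h2 := this.tendsto 0
      simp only [Finset.sum_range_succ', zero_pow (Nat.succ_ne_zero _), zero_smul,
        Finset.sum_const_zero, zero_add, pow_zero, one_smul] at h2
      exact (by simpa only [Finset.sum_range_succ', pow_zero, one_smul] using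
        h2.mono_left nhdsWithin_le_nhds)
    have hz : Filter.Tendsto (fun t : ℝ => t ^ (p + 1)) (nhdsWithin 0 (Set.Ioi 0)) (nhds 0) := by
      have : Continuous (fun t : ℝ => t ^ (p + 1)) := by fun_prop
      simpa using (this.tendsto 0).mono_left nhdsWithin_le_nhds
    have hd0 : d 0 = 0 := tendsto_nhds_unique hc (h.trans_tendsto hz)
    have h' : (fun t : ℝ => ∑ m ∈ Finset.range p, t ^ m • d (m + 1))
        =O[nhdsWithin 0 (Set.Ioi 0)] (fun t : ℝ => t ^ p) := by
      have h3 := (Asymptotics.isBigO_refl (fun t : ℝ => t⁻¹) (nhdsWithin 0 (Set.Ioi 0))).smul h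
      refine h3.congr' ?_ ?_
      · filter_upwards [self_mem_nhdsWithin] with t ht
        have ht0 : t ≠ 0 := ne_of_gt ht
        rw [Finset.sum_range_succ', hd0, smul_zero, add_zero, Finset.smul_sum]
        refine Finset.sum_congr rfl fun m _ => ?_
        rw [smul_smul, pow_succ']
        congr 1
        field_simp
      · filter_upwards [self_mem_nhdsWithin] with t ht
        have ht0 : t ≠ 0 := ne_of_gt ht
        rw [smul_eq_mul, pow_succ']
        field_simp
    intro m hm
    rcases m with _ | m
    · exact hd0
    · exact ih (fun m => d (m + 1)) h' m (by omega)

/-- A product formula agrees with the evolution up to `O(t^(p+1))`, with an analytic remainder. -/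
def HasOrder (σ : List 𝓐) (H : 𝓐) (p : ℕ) : Prop :=
  ∃ g : ℝ → 𝓐, AnalyticAt ℝ g 0 ∧ ∀ᶠ t in nhds (0 : ℝ), prodEvo σ t = evo H t + t ^ (p + 1) • g t

/-- Differentiate S = U + t^(p+1) g and substitute S' = -iGS and U' = -iHU: every term of (G - H)S
carries at least t^p, and S is unitary. Analyticity of g is what keeps the derivative of the
remainder under control; a bare bound O(t^(p+1)) could not be differentiated. -/
lemma HasOrder.generator_sub_isBigO {σ : List 𝓐} {H : 𝓐} {p : ℕ}
    (hσ : ∀ X ∈ σ, IsSelfAdjoint X) (h : HasOrder σ H p) :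
    (fun t => generator σ t - H) =O[nhds 0] (fun t : ℝ => t ^ p) := by
  obtain ⟨g, hg, he⟩ := h
  have hd : ∀ᶠ t in nhds (0 : ℝ), -Complex.I • (generator σ t * prodEvo σ t) =
      -Complex.I • (H * evo H t) +
        (t ^ (p + 1) • deriv g t + (((p + 1 : ℕ) : ℝ) * t ^ p) • g t) := by
    filter_upwards [he.eventually_nhds, hg.eventually_analyticAt] with t ht hgt
    have h1 : HasDerivAt (fun t : ℝ => evo H t + t ^ (p + 1) • g t)
        (-Complex.I • (H * evo H t) +
          (t ^ (p + 1) • deriv g t + (((p + 1 : ℕ) : ℝ) * t ^ p) • g t)) t :=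
      (hasDerivAt_evo H t).add ((hasDerivAt_pow (p + 1) t).smul hgt.differentiableAt.hasDerivAt)
    exact (hasDerivAt_prodEvo σ t).unique (h1.congr_of_eventuallyEq ht)
  have hO : ∀ {f : ℝ → 𝓐}, ContinuousAt f 0 → f =O[nhds 0] (fun _ => (1 : ℝ)) :=
    fun hf => hf.tendsto.isBigO_one ℝ
  have hpp : (fun t : ℝ => t ^ (p + 1)) =O[nhds 0] (fun t : ℝ => t ^ p) := by
    have h3 : (fun t : ℝ => t) =O[nhds 0] (fun _ => (1 : ℝ)) := continuousAt_id.tendsto.isBigO_one ℝ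
    simpa [pow_succ] using (Asymptotics.isBigO_refl (fun t : ℝ => t ^ p) _).mul h3
  have hcont_inv : ContinuousAt (fun t => star (prodEvo σ t)) 0 :=
    (analyticAt_prodEvo σ 0).continuousAt.star
  have key : (fun t => generator σ t - H) =ᶠ[nhds 0]
      fun t => (Complex.I • (t ^ (p + 1) • deriv g t + (((p + 1 : ℕ) : ℝ) * t ^ p) • g t)
        - t ^ (p + 1) • (H * g t)) * star (prodEvo σ t) := by
    filter_upwards [hd, he] with t h1 h2
    have hu : prodEvo σ t * star (prodEvo σ t) = 1 :=
      Unitary.mul_star_self_of_mem (prodEvo_mem_unitary hσ t)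
    have h3 : generator σ t * prodEvo σ t = H * evo H t +
        Complex.I • (t ^ (p + 1) • deriv g t + (((p + 1 : ℕ) : ℝ) * t ^ p) • g t) := by
      have := congrArg (fun x => Complex.I • x) h1
      simpa [smul_smul, smul_add] using this
    have h4 : (generator σ t - H) * prodEvo σ t =
        Complex.I • (t ^ (p + 1) • deriv g t + (((p + 1 : ℕ) : ℝ) * t ^ p) • g t)
        - t ^ (p + 1) • (H * g t) := by
      rw [sub_mul, h3, h2, mul_add, mul_smul_comm]
      abel
    rw [← h4, mul_assoc, hu, mul_one]
  refine key.trans_isBigO ?_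
  have h5 : (fun t => (Complex.I • (t ^ (p + 1) • deriv g t + (((p + 1 : ℕ) : ℝ) * t ^ p) • g t)
        - t ^ (p + 1) • (H * g t))) =O[nhds 0] (fun t : ℝ => t ^ p) := by
    have hadd : ∀ {f : ℝ → 𝓐} (c : ℂ), f =O[nhds 0] (fun t : ℝ => t ^ p) →
        (fun t => c • f t) =O[nhds 0] (fun t : ℝ => t ^ p) := fun c hf => hf.const_smul_left c
    refine Asymptotics.IsBigO.sub (hadd _ (.add ?_ ?_)) ?_
    · simpa using hpp.smul (hO hg.deriv.continuousAt)
    · simpa using ((Asymptotics.isBigO_refl (fun t : ℝ => t ^ p) _).const_mul_left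
        ((p + 1 : ℕ) : ℝ)).smul (hO hg.continuousAt)
    · simpa using hpp.smul (hO (continuousAt_const.mul hg.continuousAt))
  simpa using h5.mul (hO hcont_inv)

/-- Under an order condition, the generator differs from the Hamiltonian only by the remainder. -/
lemma HasOrder.sum_generatorCoeff {σ : List 𝓐} {H : 𝓐} {p : ℕ} (hp : 1 ≤ p)
    (hσ : ∀ X ∈ σ, IsSelfAdjoint X) (h : HasOrder σ H p) (τ : ℝ) :
    ∑ m ∈ Finset.range p, τ ^ m • generatorCoeff σ m = H := by
  set d : ℕ → 𝓐 := fun m => generatorCoeff σ m - if m = 0 then H else 0 with hd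
  have hs : ∀ t : ℝ, ∑ m ∈ Finset.range p, t ^ m • d m =
      (∑ m ∈ Finset.range p, t ^ m • generatorCoeff σ m) - H := by
    intro t
    simp only [hd, smul_sub, Finset.sum_sub_distrib]
    congr 1
    rw [Finset.sum_eq_single_of_mem 0 (Finset.mem_range.2 hp)]
    · simp
    · intro m _ hm; simp [hm]
  -- Both the Taylor polynomial of G and H itself are O(t^p)-close to G. Only t > 0 is used, since
  -- `generator_taylor` is one-sided.
  have hO : (fun t : ℝ => ∑ m ∈ Finset.range p, t ^ m • d m) =O[nhdsWithin 0 (Set.Ioi 0)]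
      (fun t : ℝ => t ^ p) := by
    have h1 := (h.generator_sub_isBigO hσ).mono (nhdsWithin_le_nhds (s := Set.Ioi (0 : ℝ)))
    have h2 : (fun t : ℝ => generator σ t - ∑ m ∈ Finset.range p, t ^ m • generatorCoeff σ m)
        =O[nhdsWithin 0 (Set.Ioi 0)] (fun t : ℝ => t ^ p) := by
      refine Asymptotics.IsBigO.of_bound (nestedSum σ p (fun x => ‖x‖)) ?_
      filter_upwards [self_mem_nhdsWithin] with t ht
      have := isIdealNorm_id.generator_taylor hσ hp (le_of_lt ht)
      rw [Real.norm_of_nonneg (pow_nonneg (le_of_lt ht) p), mul_comm]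
      simpa using this
    refine (h1.sub h2).congr_left fun t => ?_
    rw [hs]; abel
  have hz := sum_pow_smul_eq_zero p d hO
  have h4 := hs τ
  rw [Finset.sum_eq_zero fun m hm => by rw [hz m (by simpa using hm), smul_zero]] at h4
  exact (sub_eq_zero.1 h4.symm)

/-- The error of a product formula of order `p` is controlled by nested commutators of depth `p`. -/
theorem IsIdealNorm.prodEvo_sub_evo_le {ι : 𝓐 →L[ℂ] V} (hι : IsIdealNorm ι) {σ : List 𝓐} {H : 𝓐}
    {p : ℕ} (hp : 1 ≤ p) (hσ : ∀ X ∈ σ, IsSelfAdjoint X) (hH : IsSelfAdjoint H)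
    (h : HasOrder σ H p) {t : ℝ} (ht : 0 ≤ t) :
    ‖ι (prodEvo σ t - evo H t)‖ ≤ nestedSum σ p (fun x => ‖ι x‖) * t ^ (p + 1) := by
  have hW : 0 ≤ nestedSum σ p (fun x => ‖ι x‖) :=
    (norm_nonneg _).trans (norm_nestedSum_le σ p fun x => ι x)
  -- Interaction picture: e^{iHs} S(s) - 1 vanishes at 0, and its velocity is G - H between two
  -- unitaries.
  have hd : ∀ s : ℝ, HasDerivAt (fun s => ι (evo H (-s) * prodEvo σ s - 1))
      (ι (-Complex.I • (evo H (-s) * (generator σ s - H) * prodEvo σ s))) s := by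
    intro s
    have h1 := ((hasDerivAt_evo_neg H s).mul (hasDerivAt_prodEvo σ s)).sub_const 1
    have h2 := (ι.restrictScalars ℝ).hasFDerivAt.comp_hasDerivAt s h1
    refine h2.congr_deriv ?_
    change ι _ = ι _
    congr 1
    simp only [mul_sub, sub_mul, smul_sub, smul_mul_assoc, mul_smul_comm, mul_assoc, neg_smul,
      mul_neg]
    abel
  have hb := norm_le_pow_of_deriv (j := p) (C := nestedSum σ p (fun x => ‖ι x‖)) hd (by simp [prodEvo]) (by
    intro s hs
    rw [map_smul, norm_smul, norm_neg, Complex.norm_I, one_mul]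
    refine (hι.mul_unitary (prodEvo_mem_unitary hσ s) _).trans
      ((hι.unitary_mul (evo_mem_unitary hH _) _).trans ?_)
    have h1 := hι.generator_taylor hσ hp hs
    rw [h.sum_generatorCoeff hp hσ] at h1
    refine h1.trans ?_
    rw [mul_comm]
    refine mul_le_mul_of_nonneg_left ?_ hW
    -- Integration would give an extra factor 1/(p+1), which is discarded here.
    refine le_mul_of_one_le_left (by positivity) ?_
    push_cast
    linarith [(Nat.cast_nonneg p : (0 : ℝ) ≤ p)]) ht
  refine le_trans ?_ hb
  have h2 := hι.unitary_mul (evo_mem_unitary hH t) (evo H (-t) * prodEvo σ t - 1)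
  rwa [mul_sub, ← mul_assoc, evo_mul_neg, one_mul, mul_one] at h2

end Generic

end ProductFormula

namespace ProductFormula

/-! ### Order of the symmetric and of Suzuki's formulas -/

section Order

variable {𝓐 : Type*} [CStarAlgebra 𝓐]

/-- `S = U + t^m g` near `0` with `g` analytic and `g 0 = E`, where `U 0 = 1`. -/
structure Approx (S U : ℝ → 𝓐) (m : ℕ) (E : 𝓐) : Prop where
  analyticAt : AnalyticAt ℝ U 0
  apply_zero : U 0 = 1
  exists_remainder : ∃ g : ℝ → 𝓐, AnalyticAt ℝ g 0 ∧ g 0 = E ∧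
    ∀ᶠ t in nhds (0 : ℝ), S t = U t + t ^ m • g t

/-- Both limits are 1 at t = 0, so to leading order the errors simply add; the product of the two
errors has an extra t^m, which dies at 0 because m ≥ 1. -/
lemma Approx.mul {S U S' U' : ℝ → 𝓐} {m : ℕ} {E E' : 𝓐} (hm : 1 ≤ m) (h : Approx S U m E)
    (h' : Approx S' U' m E') :
    Approx (fun t => S t * S' t) (fun t => U t * U' t) m (E + E') := by
  obtain ⟨hU, hU1, g, hg, rfl, he⟩ := h
  obtain ⟨hU', hU1', g', hg', rfl, he'⟩ := h'
  have hp : AnalyticAt ℝ (fun t : ℝ => t ^ m) 0 := analyticAt_id.pow m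
  refine ⟨hU.mul hU', by simp [hU1, hU1'],
    fun t => g t * U' t + U t * g' t + t ^ m • (g t * g' t),
    ((hg.mul hU').add (hU.mul hg')).add (hp.smul (hg.mul hg')), ?_, ?_⟩
  · simp [hU1, hU1', zero_pow (by omega : m ≠ 0)]
  · filter_upwards [he, he'] with t h1 h2
    rw [h1, h2]
    simp only [add_mul, mul_add, smul_add, smul_mul_assoc, mul_smul_comm]
    abel

lemma Approx.comp_mul {S U : ℝ → 𝓐} {m : ℕ} {E : 𝓐} (h : Approx S U m E) (c : ℝ) :
    Approx (fun t => S (c * t)) (fun t => U (c * t)) m (c ^ m • E) := by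
  obtain ⟨hU, hU1, g, hg, rfl, he⟩ := h
  have hc : AnalyticAt ℝ (fun t : ℝ => c * t) 0 := analyticAt_const.mul analyticAt_id
  have h0 : c * 0 = 0 := mul_zero c
  refine ⟨AnalyticAt.comp (g := U) (by simpa using hU) hc, by simp [hU1],
    fun t => c ^ m • g (c * t),
    analyticAt_const.smul (AnalyticAt.comp (g := g) (by simpa using hg) hc), by simp, ?_⟩
  have ht : Filter.Tendsto (fun t : ℝ => c * t) (nhds 0) (nhds 0) := by
    simpa using hc.continuousAt.tendsto
  filter_upwards [ht.eventually he] with t h1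
  rw [h1, mul_pow, smul_smul, mul_comm (c ^ m)]

lemma exists_eq_smul_of_analyticAt {g : ℝ → 𝓐} (hg : AnalyticAt ℝ g 0) (h0 : g 0 = 0) :
    ∃ g' : ℝ → 𝓐, AnalyticAt ℝ g' 0 ∧ g' 0 = deriv g 0 ∧ ∀ t, g t = t • g' t := by
  obtain ⟨q, hq⟩ := hg
  refine ⟨dslope g 0, ⟨_, hq.has_fpower_series_dslope_fslope⟩, dslope_same g 0, fun t => ?_⟩
  have := sub_smul_dslope g 0 t
  simpa [h0] using this.symm

lemma Approx.succ {S U : ℝ → 𝓐} {m : ℕ} (h : Approx S U m 0) : ∃ E, Approx S U (m + 1) E := by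
  obtain ⟨hU, hU1, g, hg, hg0, he⟩ := h
  obtain ⟨g', hg', -, h'⟩ := exists_eq_smul_of_analyticAt hg hg0
  refine ⟨g' 0, hU, hU1, g', hg', rfl, ?_⟩
  filter_upwards [he] with t ht
  rw [ht, h' t, smul_smul, pow_succ]

/-- The leading error of a time-symmetric formula is of even order. -/
lemma Approx.eq_zero_of_symmetric {S U : ℝ → 𝓐} {m : ℕ} {E : 𝓐} (hm : Even m) (hm1 : 1 ≤ m)
    (h : Approx S U m E) (hS : ∀ t, S t * S (-t) = 1) (hU : ∀ t, U t * U (-t) = 1) : E = 0 := by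
  -- Compare the product of the values at t and -t with 1 = 1: its leading error E + (-1)^m E = 2E
  -- has to vanish.
  have h' := h.mul hm1 (h.comp_mul (-1))
  simp only [neg_one_mul, hS, hU, hm.neg_pow, one_pow, one_smul] at h'
  obtain ⟨-, -, g, hg, hg0, he⟩ := h'
  have hz : ∀ᶠ t in nhdsWithin (0 : ℝ) {0}ᶜ, g t = 0 := by
    filter_upwards [he.filter_mono nhdsWithin_le_nhds, self_mem_nhdsWithin] with t ht ht0
    have h1 : t ^ m • g t = 0 := by simpa using ht
    exact (smul_eq_zero.1 h1).resolve_left (pow_ne_zero m ht0)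
  have h1 : Filter.Tendsto g (nhdsWithin 0 {0}ᶜ) (nhds (g 0)) :=
    hg.continuousAt.tendsto.mono_left nhdsWithin_le_nhds
  have h2 : g 0 = 0 := tendsto_nhds_unique h1 (tendsto_const_nhds.congr' (by
    filter_upwards [hz] with t ht using ht.symm))
  rw [h2] at hg0
  have h3 : (2 : ℝ) • E = 0 := by rw [two_smul, ← hg0]
  exact (smul_eq_zero.1 h3).resolve_left two_ne_zero

lemma hasOrder_iff {σ : List 𝓐} {H : 𝓐} {p : ℕ} :
    HasOrder σ H p ↔ ∃ E, Approx (prodEvo σ) (evo H) (p + 1) E := by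
  constructor
  · rintro ⟨g, hg, he⟩
    exact ⟨g 0, analyticAt_evo H 0, evo_zero_time H, g, hg, rfl, he⟩
  · rintro ⟨E, -, -, g, hg, -, he⟩
    exact ⟨g, hg, he⟩

lemma generator_zero (σ : List 𝓐) : generator σ 0 = σ.sum := by
  induction σ with
  | nil => rfl
  | cons X σ ih => simp [generator, conjEvo, ih]

lemma prodEvo_zero_time (σ : List 𝓐) : prodEvo σ 0 = 1 := by simp [prodEvo]

/-- Values and first derivatives at 0 agree, because no conjugation acts in the generator at time 0.
Two factors of t can therefore be divided out. -/
lemma hasOrder_one (σ : List 𝓐) : HasOrder σ σ.sum 1 := by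
  have hf : AnalyticAt ℝ (fun t => prodEvo σ t - evo σ.sum t) 0 :=
    (analyticAt_prodEvo σ 0).sub (analyticAt_evo _ 0)
  obtain ⟨g, hg, hg0, h⟩ := exists_eq_smul_of_analyticAt hf (by simp [prodEvo_zero_time])
  have hd : deriv (fun t => prodEvo σ t - evo σ.sum t) 0 = 0 := by
    refine (((hasDerivAt_prodEvo σ 0).sub (hasDerivAt_evo σ.sum 0)).deriv).trans ?_
    simp [generator_zero, prodEvo_zero_time]
  rw [hd] at hg0
  have h1 : Approx (prodEvo σ) (evo σ.sum) 1 0 :=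
    ⟨analyticAt_evo _ 0, evo_zero_time _, g, hg, hg0,
      Filter.Eventually.of_forall fun t => by rw [pow_one, ← h]; abel⟩
  exact hasOrder_iff.2 h1.succ

lemma HasOrder.succ_of_symmetric {σ : List 𝓐} {H : 𝓐} {p : ℕ} (hp : Even (p + 1))
    (h : HasOrder σ H p) (hσ : ∀ t, prodEvo σ t * prodEvo σ (-t) = 1) : HasOrder σ H (p + 1) := by
  obtain ⟨E, hE⟩ := hasOrder_iff.1 h
  have h0 : E = 0 := hE.eq_zero_of_symmetric hp (by omega) hσ (evo_mul_neg H)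
  rw [h0] at hE
  exact hasOrder_iff.2 hE.succ

lemma prodEvo_mul_reverse (σ : List 𝓐) (t : ℝ) :
    prodEvo σ t * prodEvo σ.reverse (-t) = 1 := by
  induction σ with
  | nil => simp
  | cons X σ ih =>
    rw [List.reverse_cons, prodEvo_append, prodEvo_cons]
    have : evo X t * prodEvo σ t * (prodEvo σ.reverse (-t) * prodEvo [X] (-t)) =
        evo X t * (prodEvo σ t * prodEvo σ.reverse (-t)) * prodEvo [X] (-t) := by
      noncomm_ring
    rw [this, ih]
    simp

/-- A palindromic product is inverted by t ↦ -t, so its error of order t² is absent. -/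
lemma hasOrder_two {σ : List 𝓐} (hσ : σ.reverse = σ) : HasOrder σ σ.sum 2 :=
  (hasOrder_one σ).succ_of_symmetric even_two fun t => by
    simpa only [hσ] using prodEvo_mul_reverse σ t

/-- Suzuki's recursion on lists of exponents. -/
def suzukiStep (c : ℝ) (σ : List 𝓐) : List 𝓐 :=
  let τ := σ.map fun X => c • X
  τ ++ (τ ++ ((σ.map fun X => (1 - 4 * c) • X) ++ (τ ++ τ)))

lemma prodEvo_suzukiStep (c : ℝ) (σ : List 𝓐) (t : ℝ) :
    prodEvo (suzukiStep c σ) t = prodEvo σ (c * t) * (prodEvo σ (c * t) *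
      (prodEvo σ ((1 - 4 * c) * t) * (prodEvo σ (c * t) * prodEvo σ (c * t)))) := by
  simp only [suzukiStep, prodEvo_append, prodEvo_smul]

lemma suzukiStep_symmetric {c : ℝ} {σ : List 𝓐} (hσ : ∀ t, prodEvo σ t * prodEvo σ (-t) = 1)
    (t : ℝ) : prodEvo (suzukiStep c σ) t * prodEvo (suzukiStep c σ) (-t) = 1 := by
  have h : ∀ a x, prodEvo σ (a * t) * (prodEvo σ (a * (-t)) * x) = x := fun a x => by
    rw [← mul_assoc, mul_neg, hσ, one_mul]
  simp only [prodEvo_suzukiStep, mul_assoc, h]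
  rw [mul_neg, hσ]

/-- The five leading errors at t^(2q+1) add up to (4c^(2q+1) + (1-4c)^(2q+1))E = 0, which gains one
order. Symmetry then forbids an error at t^(2q+2), which gains a second. -/
lemma HasOrder.suzukiStep {c : ℝ} {σ : List 𝓐} {H : 𝓐} {q : ℕ} (h : HasOrder σ H (2 * q))
    (hσ : ∀ t, prodEvo σ t * prodEvo σ (-t) = 1)
    (hc : 4 * c ^ (2 * q + 1) + (1 - 4 * c) ^ (2 * q + 1) = 0) :
    HasOrder (suzukiStep c σ) H (2 * (q + 1)) := by
  obtain ⟨E, hE⟩ := hasOrder_iff.1 h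
  have hm : 1 ≤ 2 * q + 1 := by omega
  have h1 := hE.comp_mul c
  have h2 := hE.comp_mul (1 - 4 * c)
  have h3 := h1.mul hm (h1.mul hm (h2.mul hm (h1.mul hm h1)))
  have hS : (fun t => prodEvo σ (c * t) * (prodEvo σ (c * t) *
      (prodEvo σ ((1 - 4 * c) * t) * (prodEvo σ (c * t) * prodEvo σ (c * t))))) =
      prodEvo (ProductFormula.suzukiStep c σ) := funext fun t => (prodEvo_suzukiStep c σ t).symm
  have hU : (fun t => evo H (c * t) * (evo H (c * t) *
      (evo H ((1 - 4 * c) * t) * (evo H (c * t) * evo H (c * t))))) = evo H := by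
    funext t
    simp only [← evo_add]
    congr 1; ring
  have hE0 : c ^ (2 * q + 1) • E + (c ^ (2 * q + 1) • E + ((1 - 4 * c) ^ (2 * q + 1) • E +
      (c ^ (2 * q + 1) • E + c ^ (2 * q + 1) • E))) = 0 := by
    simp only [← add_smul]
    rw [show c ^ (2 * q + 1) + (c ^ (2 * q + 1) + ((1 - 4 * c) ^ (2 * q + 1) +
      (c ^ (2 * q + 1) + c ^ (2 * q + 1)))) = 4 * c ^ (2 * q + 1) + (1 - 4 * c) ^ (2 * q + 1) by ring,
      hc, zero_smul]
  rw [hS, hU, hE0] at h3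
  have he : Even (2 * q + 1 + 1) := ⟨q + 1, by ring⟩
  exact (hasOrder_iff.2 h3.succ).succ_of_symmetric he (suzukiStep_symmetric hσ)

lemma sum_map_suzukiStep (c : ℝ) (σ : List 𝓐) {φ : 𝓐 → ℝ} (hφ : ∀ (a : ℝ) X, φ (a • X) = |a| * φ X) :
    ((suzukiStep c σ).map φ).sum = (4 * |c| + |1 - 4 * c|) * (σ.map φ).sum := by
  have h : ∀ a : ℝ, ((σ.map fun X => a • X).map φ).sum = |a| * (σ.map φ).sum := fun a => by
    simp [Function.comp_def, hφ, List.sum_map_mul_left]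
  simp only [suzukiStep, List.map_append, List.sum_append, h]
  ring

/-- The coefficient of Suzuki's recursion cancels the leading error. -/
lemma suzuki_coeff_eq (m : ℕ) :
    let c : ℝ := 1 / (4 - (4 : ℝ) ^ ((1 : ℝ) / (2 * ((m : ℝ) + 2) - 1)))
    4 * c ^ (2 * (m + 1) + 1) + (1 - 4 * c) ^ (2 * (m + 1) + 1) = 0 := by
  intro c
  set x : ℝ := (4 : ℝ) ^ ((1 : ℝ) / (2 * ((m : ℝ) + 2) - 1)) with hx
  have hm : (0 : ℝ) ≤ m := Nat.cast_nonneg m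
  have hxp : x ^ (2 * (m + 1) + 1) = 4 := by
    rw [hx, ← Real.rpow_natCast, ← Real.rpow_mul (by norm_num)]
    have : (1 : ℝ) / (2 * ((m : ℝ) + 2) - 1) * ((2 * (m + 1) + 1 : ℕ) : ℝ) = 1 := by
      push_cast
      rw [show (2 : ℝ) * (m + 2) - 1 = 2 * (m + 1) + 1 by ring]
      field_simp
    rw [this, Real.rpow_one]
  have hx4 : x < 4 := by
    have : x < (4 : ℝ) ^ (1 : ℝ) := by
      apply Real.rpow_lt_rpow_of_exponent_lt (by norm_num)
      rw [div_lt_one (by linarith)]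
      linarith
    simpa using this
  have h4 : 4 - x ≠ 0 := by linarith
  -- With c = 1/(4 - x) and x^(2m+3) = 4, the odd power of 1 - 4c is exactly -4c^(2m+3).
  have hc : 1 - 4 * c = -(x * c) := by
    have hc' : c = 1 / (4 - x) := rfl
    rw [hc']
    field_simp
    ring
  rw [hc, Odd.neg_pow ⟨m + 1, rfl⟩, mul_pow, hxp]
  ring

end Order

/-! ### Bounding nested commutators by locality -/

section Locality

variable {𝓐 : Type*} [CStarAlgebra 𝓐] {V : Type*} [NormedAddCommGroup V] [NormedSpace ℂ V]

/-- The predicate `P m` carries the locality gained after m commutators, so that φ and ψ need only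
be compared on operators that can occur. -/
lemma nestedSum_mono {P : ℕ → 𝓐 → Prop} {σ : List 𝓐} (h0 : ∀ X ∈ σ, P 0 X)
    (hT : ∀ X ∈ σ, ∀ m j x, P m x → P (m + j) (taylorTerm X j x)) (m : ℕ) {φ ψ : 𝓐 → ℝ}
    (h : ∀ x, P m x → φ x ≤ ψ x) : nestedSum σ m φ ≤ nestedSum σ m ψ := by
  induction σ generalizing m φ ψ with
  | nil => simp [nestedSum]
  | cons X σ ih =>
    simp only [nestedSum]
    refine add_le_add ?_ (Finset.sum_le_sum fun j hj => ?_)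
    · split_ifs with hm
      · exact h X (hm ▸ h0 X (by simp))
      · exact le_rfl
    · refine ih (fun Y hY => h0 Y (by simp [hY])) (fun Y hY => hT Y (by simp [hY])) _
        fun x hx => h _ ?_
      have h1 := hT X (by simp) (m - j) j x hx
      rwa [Nat.sub_add_cancel (by simpa [Nat.lt_succ_iff] using hj)] at h1

lemma nestedSum_nonneg {σ : List 𝓐} (m : ℕ) {φ : 𝓐 → ℝ} (h : ∀ x, 0 ≤ φ x) :
    0 ≤ nestedSum σ m φ := by
  induction σ generalizing m φ with
  | nil => simp [nestedSum]
  | cons X σ ih =>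
    simp only [nestedSum]
    refine add_nonneg ?_ (Finset.sum_nonneg fun j _ => ih _ fun x => h _)
    split_ifs
    exacts [h X, le_rfl]

lemma nestedSum_le_cons (X : 𝓐) (σ : List 𝓐) (m : ℕ) {φ : 𝓐 → ℝ} (h : ∀ x, 0 ≤ φ x) :
    nestedSum σ m φ ≤ nestedSum (X :: σ) m φ := by
  rw [nestedSum, Finset.sum_range_succ']
  simp only [taylorTerm_zero, Nat.sub_zero]
  have h1 : 0 ≤ ∑ j ∈ Finset.range m, nestedSum σ (m - (j + 1)) (fun x => φ (taylorTerm X (j + 1) x)) :=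
    Finset.sum_nonneg fun j _ => nestedSum_nonneg _ fun x => h _
  have h2 : 0 ≤ if m = 0 then φ X else 0 := by split_ifs; exacts [h X, le_rfl]
  linarith

/-- A nested sum of positive depth is at most the sum over all choices of the outermost block of
equal commutators, the inner commutators being unrestricted. -/
lemma nestedSum_succ_le (σ : List 𝓐) (m : ℕ) {φ : 𝓐 → ℝ} (h : ∀ x, 0 ≤ φ x) :
    nestedSum σ (m + 1) φ ≤ ∑ j ∈ Finset.range (m + 1), (σ.map fun X =>
      nestedSum σ (m - j) (fun x => φ (taylorTerm X (j + 1) x))).sum := by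
  -- The outermost exponent runs through a suffix τ that shrinks in the induction, while the inner
  -- sums stay over the whole σ; all that is needed of τ is that its nested sums are dominated by
  -- those of σ.
  suffices H : ∀ τ : List 𝓐, (∀ l (ψ : 𝓐 → ℝ), (∀ x, 0 ≤ ψ x) →
      nestedSum τ l ψ ≤ nestedSum σ l ψ) →
      nestedSum τ (m + 1) φ ≤ ∑ j ∈ Finset.range (m + 1), (τ.map fun X =>
        nestedSum σ (m - j) (fun x => φ (taylorTerm X (j + 1) x))).sum from
    H σ fun _ _ _ => le_rfl
  intro τ
  induction τ with
  | nil => intro _; simp [nestedSum]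
  | cons X τ ih =>
    intro hτ
    have hτ' : ∀ l (ψ : 𝓐 → ℝ), (∀ x, 0 ≤ ψ x) → nestedSum τ l ψ ≤ nestedSum σ l ψ :=
      fun l ψ hψ => (nestedSum_le_cons X τ l hψ).trans (hτ l ψ hψ)
    rw [nestedSum, if_neg (Nat.succ_ne_zero m), zero_add, Finset.sum_range_succ']
    simp only [taylorTerm_zero, Nat.sub_zero, List.map_cons, List.sum_cons, Finset.sum_add_distrib]
    refine add_le_add (Finset.sum_le_sum fun j _ => ?_) (ih hτ')
    rw [show m + 1 - (j + 1) = m - j by omega]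
    exact hτ' _ _ fun x => h _

lemma list_sum_nestedSum {α : Type*} (l : List α) (σ : List 𝓐) (m : ℕ) (φ : α → 𝓐 → ℝ) :
    (l.map fun a => nestedSum σ m (φ a)).sum = nestedSum σ m (fun x => (l.map fun a => φ a x).sum) := by
  induction σ generalizing m φ with
  | nil => simp [nestedSum]
  | cons X σ ih =>
    simp only [nestedSum, List.sum_map_add, ← ih]
    congr 1
    · split_ifs <;> simp
    · clear ih
      induction l with
      | nil => simp
      | cons a l ihl => simp [ihl, Finset.sum_add_distrib]

lemma list_sum_pow_le (l : List ℝ) (h : ∀ a ∈ l, 0 ≤ a) (j : ℕ) :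
    (l.map fun a => a ^ (j + 1)).sum ≤ l.sum ^ (j + 1) := by
  induction l with
  | nil => simp
  | cons a l ih =>
    have ha := h a (by simp)
    have hl : 0 ≤ l.sum := List.sum_nonneg fun b hb => h b (by simp [hb])
    simp only [List.map_cons, List.sum_cons]
    calc a ^ (j + 1) + _ ≤ a ^ (j + 1) + l.sum ^ (j + 1) := by
          gcongr; exact ih fun b hb => h b (by simp [hb])
      _ ≤ (a + l.sum) ^ (j + 1) := by
          rw [pow_succ, pow_succ, pow_succ]
          have h1 : a ^ j ≤ (a + l.sum) ^ j := by gcongr; linarith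
          have h2 : l.sum ^ j ≤ (a + l.sum) ^ j := by gcongr; linarith
          nlinarith

open Classical in
-- A commuting `X` contributes nothing because at least one commutator is taken; otherwise each
-- commutator costs 2‖X‖. The factorial is discarded.
lemma IsIdealNorm.taylorTerm_le {ι : 𝓐 →L[ℂ] V} (hι : IsIdealNorm ι) (X x : 𝓐) (j : ℕ) :
    ‖ι (taylorTerm X (j + 1) x)‖ ≤ (if Commute X x then 0 else 2 * ‖X‖) ^ (j + 1) * ‖ι x‖ := by
  have h1 : ‖ι (taylorTerm X (j + 1) x)‖ ≤ ‖ι ((derivation X ^ (j + 1)) x)‖ := by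
    rw [taylorTerm, LinearMap.smul_apply, map_smul, norm_smul]
    refine mul_le_of_le_one_left (norm_nonneg _) ?_
    rw [norm_inv, Complex.norm_natCast]
    exact inv_le_one_of_one_le₀ (by exact_mod_cast (j + 1).factorial_pos)
  refine h1.trans ?_
  split_ifs with hc
  · have : (derivation X ^ (j + 1)) x = 0 := by
      rw [pow_succ, Module.End.mul_apply, derivation_apply, Ring.lie_def, hc.eq]
      simp
    rw [this]; simp
  · generalize j + 1 = i
    induction i with
    | zero => simp
    | succ i ih =>
      rw [pow_succ', Module.End.mul_apply, derivation_apply, map_smul, norm_smul, norm_neg,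
        Complex.norm_I, one_mul, pow_succ', mul_assoc]
      exact (hι.lie_le _ _).trans (mul_le_mul_of_nonneg_left ih (by positivity))

/-- The constants of `nestedSum_le`. -/
def nestedConst (c : ℕ → ℝ) : ℕ → ℝ
  | 0 => 1
  | m + 1 => ∑ j : Fin (m + 1), (2 * c (m - j)) ^ (j.1 + 1) * nestedConst c (m - j)

lemma nestedConst_nonneg {c : ℕ → ℝ} (hc : ∀ m, 0 ≤ c m) (m : ℕ) : 0 ≤ nestedConst c m := by
  induction m using Nat.strong_induction_on with
  | _ m ih =>
    rcases m with _ | m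
    · simp [nestedConst]
    · rw [nestedConst]
      refine Finset.sum_nonneg fun j _ => mul_nonneg (pow_nonneg ?_ _) (ih _ (by omega))
      exact mul_nonneg zero_le_two (hc _)

open Classical in
/-- If the exponents that do not commute with an operator of locality `m` have total norm at most
`c m * Λ`, then the nested commutators of depth `m` have total norm at most a constant times
`Λ ^ m`. -/
theorem IsIdealNorm.nestedSum_le {ι : 𝓐 →L[ℂ] V} (hι : IsIdealNorm ι) {P : ℕ → 𝓐 → Prop}
    {σ : List 𝓐} (h0 : ∀ X ∈ σ, P 0 X)
    (hT : ∀ X ∈ σ, ∀ m j x, P m x → P (m + j) (taylorTerm X j x)) {c : ℕ → ℝ} {Λ : ℝ}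
    (hc : ∀ m, 0 ≤ c m) (hΛ : 0 ≤ Λ)
    (hP : ∀ m x, P m x → (σ.map fun X => if Commute X x then 0 else ‖X‖).sum ≤ c m * Λ) (m : ℕ) :
    nestedSum σ m (fun x => ‖ι x‖) ≤ nestedConst c m * Λ ^ m * (σ.map fun X => ‖ι X‖).sum := by
  induction m using Nat.strong_induction_on with
  | _ m ih =>
    rcases m with _ | m
    · rw [nestedConst, pow_zero, one_mul, one_mul]
      clear h0 hT hP ih
      induction σ with
      | nil => simp [nestedSum]
      | cons X σ ih =>
        rw [nestedSum]
        simp [taylorTerm_zero]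
        exact ih
    · refine (nestedSum_succ_le σ m fun x => norm_nonneg _).trans ?_
      rw [Finset.sum_range, nestedConst, Finset.sum_mul, Finset.sum_mul]
      refine Finset.sum_le_sum fun j _ => ?_
      rw [list_sum_nestedSum]
      have h1 : nestedSum σ (m - j) (fun x => (σ.map fun X => ‖ι (taylorTerm X (j + 1) x)‖).sum)
          ≤ nestedSum σ (m - j) (fun x => (2 * (c (m - j) * Λ)) ^ (j.1 + 1) * ‖ι x‖) := by
        refine nestedSum_mono h0 hT _ fun x hx => ?_
        calc (σ.map fun X => ‖ι (taylorTerm X (j + 1) x)‖).sum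
            ≤ (σ.map fun X => (if Commute X x then 0 else 2 * ‖X‖) ^ (j.1 + 1) * ‖ι x‖).sum :=
              List.sum_le_sum fun X _ => hι.taylorTerm_le X x j
          _ = (σ.map fun X => (if Commute X x then 0 else 2 * ‖X‖) ^ (j.1 + 1)).sum * ‖ι x‖ :=
              List.sum_map_mul_right ..
          _ ≤ _ := by
              refine mul_le_mul_of_nonneg_right ?_ (norm_nonneg _)
              -- A block of j + 1 commutators with the same exponent is paid for as if the exponents
              -- were independent, giving the (j+1)-th power of the noncommuting total.
              have h2 := list_sum_pow_le (σ.map fun X => if Commute X x then 0 else 2 * ‖X‖) (by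
                intro a ha
                obtain ⟨X, -, rfl⟩ := List.mem_map.1 ha
                split_ifs <;> positivity) j
              rw [List.map_map] at h2
              refine h2.trans (pow_le_pow_left₀ (List.sum_nonneg ?_) ?_ _)
              · intro a ha
                obtain ⟨X, -, rfl⟩ := List.mem_map.1 ha
                split_ifs <;> positivity
              · have h3 : (σ.map fun X => if Commute X x then 0 else 2 * ‖X‖).sum =
                    2 * (σ.map fun X => if Commute X x then 0 else ‖X‖).sum := by
                  rw [← List.sum_map_mul_left]
                  congr 1
                  refine List.map_congr_left fun X _ => ?_
                  split_ifs <;> simp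
                rw [h3]
                exact mul_le_mul_of_nonneg_left (hP _ _ hx) zero_le_two
      refine h1.trans ?_
      refine (map_nestedSum (AddMonoidHom.mulLeft ((2 * (c (m - j) * Λ)) ^ (j.1 + 1)))
        σ (m - j) (fun x => ‖ι x‖)).symm.trans_le ?_
      rw [AddMonoidHom.coe_mulLeft]
      have h4 := ih (m - j) (by omega)
      calc _ ≤ (2 * (c (m - j) * Λ)) ^ (j.1 + 1) * (nestedConst c (m - j) * Λ ^ (m - j.1) *
            (σ.map fun X => ‖ι X‖).sum) := by
            refine mul_le_mul_of_nonneg_left h4 (pow_nonneg ?_ _)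
            have := hc (m - j); positivity
        _ = _ := by
            have e : Λ ^ (m + 1) = Λ ^ (j.1 + 1) * Λ ^ (m - j.1) := by
              rw [← pow_add]; congr 1; omega
            rw [e, ← mul_assoc 2, mul_pow (2 * c (m - j.1))]
            ring

end Locality

end ProductFormula

namespace ProductFormula

open scoped Matrix.Norms.L2Operator

variable {n : ℕ}

lemma opNorm_eq_norm (A : QOp n) : opNorm A = ‖A‖ := rfl

lemma evolution_eq_evo (A : QOp n) (t : ℝ) : evolution A t = evo A t := rfl

/-! ### Pauli strings: products, traces and supports -/

section Pauli

/-- The labels 0, 1, 2, 3 of I, X, Y, Z multiply, up to a phase, as the Klein four-group, which is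
XOR of binary digits. -/
lemma exists_pauliMatrix_mul (a b : Fin 4) :
    ∃ z : ℂ, pauliMatrix a * pauliMatrix b = z • pauliMatrix (a ^^^ b) := by
  have h : ∀ c : Fin 4, c ^^^ c = 0 := by decide
  fin_cases a <;> fin_cases b
  · exact ⟨1, by simp [pauliMatrix]⟩
  · exact ⟨1, by simp [pauliMatrix]⟩
  · exact ⟨1, by simp [pauliMatrix]⟩
  · exact ⟨1, by simp [pauliMatrix]⟩
  · exact ⟨1, by simp [pauliMatrix]⟩
  · exact ⟨1, by rw [h]; simp [pauliMatrix, ← Matrix.one_fin_two]⟩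
  · exact ⟨Complex.I, (by simp [pauliMatrix] :
      pauliMatrix 1 * pauliMatrix 2 = Complex.I • pauliMatrix 3)⟩
  · exact ⟨-Complex.I, (by simp [pauliMatrix] :
      pauliMatrix 1 * pauliMatrix 3 = (-Complex.I) • pauliMatrix 2)⟩
  · exact ⟨1, by simp [pauliMatrix]⟩
  · exact ⟨-Complex.I, (by simp [pauliMatrix] :
      pauliMatrix 2 * pauliMatrix 1 = (-Complex.I) • pauliMatrix 3)⟩
  · exact ⟨1, by rw [h]; simp [pauliMatrix, ← Matrix.one_fin_two]⟩
  · exact ⟨Complex.I, (by simp [pauliMatrix] :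
      pauliMatrix 2 * pauliMatrix 3 = Complex.I • pauliMatrix 1)⟩
  · exact ⟨1, by simp [pauliMatrix]⟩
  · exact ⟨Complex.I, (by simp [pauliMatrix] :
      pauliMatrix 3 * pauliMatrix 1 = Complex.I • pauliMatrix 2)⟩
  · exact ⟨-Complex.I, (by simp [pauliMatrix] :
      pauliMatrix 3 * pauliMatrix 2 = (-Complex.I) • pauliMatrix 1)⟩
  · exact ⟨1, by rw [h]; simp [pauliMatrix, ← Matrix.one_fin_two]⟩

lemma pauliMatrix_isHermitian (a : Fin 4) : (pauliMatrix a)ᴴ = pauliMatrix a := by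
  fin_cases a <;> ext i j <;> fin_cases i <;> fin_cases j <;> simp [pauliMatrix]

lemma trace_pauliMatrix {a : Fin 4} (ha : a ≠ 0) : (pauliMatrix a).trace = 0 := by
  fin_cases a
  · exact absurd rfl ha
  all_goals simp [pauliMatrix, Matrix.trace_fin_two]

lemma pauliString_mul_apply (P Q : Fin n → Fin 4) (x z : Fin n → Fin 2) :
    (pauliString P * pauliString Q) x z =
      ∏ q, (pauliMatrix (P q) * pauliMatrix (Q q)) (x q) (z q) := by
  simp only [Matrix.mul_apply, pauliString, Matrix.of_apply, ← Finset.prod_mul_distrib,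
    Finset.prod_univ_sum, Fintype.piFinset_univ]

/-- The product of two Pauli strings, up to a phase. -/
def pauliXor (P Q : Fin n → Fin 4) : Fin n → Fin 4 := fun q => P q ^^^ Q q

lemma exists_pauliString_mul (P Q : Fin n → Fin 4) :
    ∃ z : ℂ, pauliString P * pauliString Q = z • pauliString (pauliXor P Q) := by
  choose z hz using exists_pauliMatrix_mul
  refine ⟨∏ q, z (P q) (Q q), ?_⟩
  ext x y
  rw [pauliString_mul_apply]
  simp [hz, pauliString, pauliXor, Finset.prod_mul_distrib]

lemma mem_pauliSupport {P : Fin n → Fin 4} {q : Fin n} : q ∈ pauliSupport P ↔ P q ≠ 0 := by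
  simp [pauliSupport]

lemma commute_pauliString {P Q : Fin n → Fin 4} (h : Disjoint (pauliSupport P) (pauliSupport Q)) :
    Commute (pauliString P) (pauliString Q) := by
  ext x y
  rw [pauliString_mul_apply, pauliString_mul_apply]
  refine Finset.prod_congr rfl fun q _ => ?_
  have h1 : P q = 0 ∨ Q q = 0 := by
    by_contra! hc
    exact Finset.disjoint_left.1 h (mem_pauliSupport.2 hc.1) (mem_pauliSupport.2 hc.2)
  rcases h1 with h1 | h1 <;> simp [h1, pauliMatrix]

lemma conjTranspose_pauliString (P : Fin n → Fin 4) : (pauliString P)ᴴ = pauliString P := by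
  ext x y
  rw [Matrix.conjTranspose_apply, pauliString, Matrix.of_apply, Matrix.of_apply, star_prod]
  refine Finset.prod_congr rfl fun q _ => ?_
  conv_rhs => rw [← pauliMatrix_isHermitian (P q)]
  rfl

lemma trace_pauliString (P : Fin n → Fin 4) :
    (pauliString P).trace = ∏ q, (pauliMatrix (P q)).trace := by
  simp only [Matrix.trace, Matrix.diag, pauliString, Matrix.of_apply, Finset.prod_univ_sum,
    Fintype.piFinset_univ]

/-- Where the labels differ, the product carries a nontrivial Pauli matrix, and one traceless factor
kills the trace. -/
lemma trace_pauliString_mul {P Q : Fin n → Fin 4} (h : P ≠ Q) :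
    (pauliString P * pauliString Q).trace = 0 := by
  obtain ⟨z, hz⟩ := exists_pauliString_mul P Q
  obtain ⟨q, hq⟩ := Function.ne_iff.1 h
  have h0 : ∀ a b : Fin 4, a ≠ b → a ^^^ b ≠ 0 := by decide
  rw [hz, Matrix.trace_smul, trace_pauliString,
    Finset.prod_eq_zero (Finset.mem_univ q) (trace_pauliMatrix (h0 _ _ hq)), smul_zero]

/-- The operators that are combinations of a given set of Pauli strings. -/
def pauliSpan (Ps : Set (Fin n → Fin 4)) : Submodule ℂ (QOp n) :=
  Submodule.span ℂ {B : QOp n | ∃ P : Fin n → Fin 4, P ∈ Ps ∧ B = pauliString P}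

lemma mul_mem_pauliSpan {Ps Qs Rs : Set (Fin n → Fin 4)} (h : ∀ P ∈ Ps, ∀ Q ∈ Qs, pauliXor P Q ∈ Rs)
    {A B : QOp n} (hA : A ∈ pauliSpan Ps) (hB : B ∈ pauliSpan Qs) : A * B ∈ pauliSpan Rs := by
  have h1 : A * B ∈ pauliSpan Ps * pauliSpan Qs := Submodule.mul_mem_mul hA hB
  rw [pauliSpan, pauliSpan, Submodule.span_mul_span] at h1
  refine (Submodule.span_le.2 ?_) h1
  rintro _ ⟨_, ⟨P, hP, rfl⟩, _, ⟨Q, hQ, rfl⟩, rfl⟩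
  obtain ⟨z, hz⟩ := exists_pauliString_mul P Q
  change pauliString P * pauliString Q ∈ pauliSpan Rs
  rw [hz]
  exact Submodule.smul_mem _ _ (Submodule.subset_span ⟨_, h P hP Q hQ, rfl⟩)

lemma pauliSpan_mono {Ps Qs : Set (Fin n → Fin 4)} (h : Ps ⊆ Qs) : pauliSpan Ps ≤ pauliSpan Qs :=
  Submodule.span_mono fun _ ⟨P, hP, hB⟩ => ⟨P, h hP, hB⟩

lemma commute_of_mem_pauliSpan {Ps Qs : Set (Fin n → Fin 4)}
    (h : ∀ P ∈ Ps, ∀ Q ∈ Qs, Disjoint (pauliSupport P) (pauliSupport Q))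
    {A B : QOp n} (hA : A ∈ pauliSpan Ps) (hB : B ∈ pauliSpan Qs) : Commute A B := by
  induction hA using Submodule.span_induction with
  | zero => exact Commute.zero_left _
  | add x y _ _ hx hy => exact hx.add_left hy
  | smul c x _ hx => exact hx.smul_left c
  | mem x hx =>
    obtain ⟨P, hP, rfl⟩ := hx
    induction hB using Submodule.span_induction with
    | zero => exact Commute.zero_right _
    | add x y _ _ hx hy => exact hx.add_right hy
    | smul c x _ hx => exact hx.smul_right c
    | mem x hx =>
      obtain ⟨Q, hQ, rfl⟩ := hx
      exact commute_pauliString (h P hP Q hQ)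

lemma trace_mul_conjTranspose_eq_zero {Ps Qs : Set (Fin n → Fin 4)} (h : Disjoint Ps Qs)
    {A B : QOp n} (hA : A ∈ pauliSpan Ps) (hB : B ∈ pauliSpan Qs) : (A * Bᴴ).trace = 0 := by
  induction hA using Submodule.span_induction with
  | zero => simp
  | add x y _ _ hx hy => rw [add_mul, Matrix.trace_add, hx, hy, add_zero]
  | smul c x _ hx => rw [smul_mul_assoc, Matrix.trace_smul, hx, smul_zero]
  | mem x hx =>
    obtain ⟨P, hP, rfl⟩ := hx
    induction hB using Submodule.span_induction with
    | zero => simp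
    | add x y _ _ hx hy =>
      rw [Matrix.conjTranspose_add, mul_add, Matrix.trace_add, hx, hy, add_zero]
    | smul c x _ hx =>
      rw [Matrix.conjTranspose_smul, mul_smul_comm, Matrix.trace_smul, hx, smul_zero]
    | mem x hx =>
      obtain ⟨Q, hQ, rfl⟩ := hx
      rw [conjTranspose_pauliString]
      exact trace_pauliString_mul fun hPQ => Set.disjoint_left.1 h hP (hPQ ▸ hQ)

lemma ActsWithin.mono {S T : Finset (Fin n)} (h : S ⊆ T) {A : QOp n} (hA : ActsWithin S A) :
    ActsWithin T A :=
  pauliSpan_mono (fun _ hP => Finset.Subset.trans hP h) hA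

lemma ActsWithin.mul {S T : Finset (Fin n)} {A B : QOp n} (hA : ActsWithin S A)
    (hB : ActsWithin T B) : ActsWithin (S ∪ T) (A * B) := by
  refine mul_mem_pauliSpan (fun P hP Q hQ q hq => ?_) hA hB
  rw [Finset.mem_union]
  by_contra! hc
  have h1 : P q = 0 := by
    by_contra h; exact hc.1 (hP (mem_pauliSupport.2 h))
  have h2 : Q q = 0 := by
    by_contra h; exact hc.2 (hQ (mem_pauliSupport.2 h))
  rw [mem_pauliSupport, pauliXor, h1, h2] at hq
  exact hq (by decide)

lemma ActsWithin.commute {S T : Finset (Fin n)} (h : Disjoint S T) {A B : QOp n}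
    (hA : ActsWithin S A) (hB : ActsWithin T B) : Commute A B :=
  commute_of_mem_pauliSpan (fun _ hP _ hQ => Finset.disjoint_of_subset_left hP
    (Finset.disjoint_of_subset_right hQ h)) hA hB

/-- The commutator of an operator on `S` with an operator of exact support `T` acts on exactly
`T \ S` outside `S`. -/
lemma lie_mem_pauliSpan {S T : Finset (Fin n)} {A B : QOp n} (hA : ActsWithin S A)
    (hB : ActsExactlyOn T B) : ⁅A, B⁆ ∈ pauliSpan {P | pauliSupport P \ S = T \ S} := by
  -- Outside S the first string has label 0, and XOR with 0 leaves the labels of the second string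
  -- unchanged.
  have key : ∀ P Q : Fin n → Fin 4, pauliSupport P ⊆ S → pauliSupport Q = T →
      pauliSupport (pauliXor P Q) \ S = T \ S ∧ pauliSupport (pauliXor Q P) \ S = T \ S := by
    rintro P Q hP rfl
    have h0 : ∀ a : Fin 4, (0 : Fin 4) ^^^ a = a ∧ a ^^^ 0 = a := by decide
    constructor <;>
    · ext q
      simp only [Finset.mem_sdiff, mem_pauliSupport, pauliXor]
      refine and_congr_left fun hq => ?_
      have h1 : P q = 0 := by by_contra h; exact hq (hP (mem_pauliSupport.2 h))
      simp [h1, h0]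
  rw [Ring.lie_def]
  exact Submodule.sub_mem _ (mul_mem_pauliSpan (fun P hP Q hQ => (key P Q hP hQ).1) hA hB)
    (mul_mem_pauliSpan (fun Q hQ P hP => (key P Q hP hQ).2) hB hA)

end Pauli

/-! ### The Frobenius norm as an ideal norm -/

section Frobenius

lemma trace_mul_conjTranspose_self (A : QOp n) :
    (A * Aᴴ).trace.re = ∑ p : (Fin n → Fin 2) × (Fin n → Fin 2), ‖A p.1 p.2‖ ^ 2 := by
  rw [Fintype.sum_prod_type]
  simp only [Matrix.trace, Matrix.diag, Matrix.mul_apply, Matrix.conjTranspose_apply,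
    Complex.re_sum]
  refine Finset.sum_congr rfl fun x _ => Finset.sum_congr rfl fun y _ => ?_
  rw [Complex.star_def, Complex.mul_conj, Complex.ofReal_re, Complex.normSq_eq_norm_sq]

/-- The entries of an operator, as a vector of the Euclidean space whose norm is the Frobenius
norm. -/
def frobMap : QOp n →L[ℂ] EuclideanSpace ℂ ((Fin n → Fin 2) × (Fin n → Fin 2)) :=
  LinearMap.toContinuousLinearMap
    { toFun := fun A => WithLp.toLp 2 fun p => A p.1 p.2
      map_add' := fun _ _ => rfl
      map_smul' := fun _ _ => rfl }

lemma norm_frobMap (A : QOp n) : ‖frobMap A‖ = frobNorm A := by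
  rw [EuclideanSpace.norm_eq, frobNorm, trace_mul_conjTranspose_self]
  rfl

lemma frobNorm_nonneg (A : QOp n) : 0 ≤ frobNorm A := Real.sqrt_nonneg _

lemma frobNorm_sq (A : QOp n) :
    frobNorm A ^ 2 = ∑ p : (Fin n → Fin 2) × (Fin n → Fin 2), ‖A p.1 p.2‖ ^ 2 := by
  rw [← trace_mul_conjTranspose_self, frobNorm, Real.sq_sqrt]
  rw [trace_mul_conjTranspose_self]
  positivity

lemma frobNorm_conjTranspose (A : QOp n) : frobNorm Aᴴ = frobNorm A := by
  refine (pow_left_inj₀ (frobNorm_nonneg _) (frobNorm_nonneg _) two_ne_zero).1 ?_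
  rw [frobNorm_sq, frobNorm_sq, Fintype.sum_prod_type_right, Fintype.sum_prod_type]
  simp

/-- The squared Frobenius norm is the sum of the squared lengths of the columns, and `A` acts on
each column of `B` separately. -/
lemma frobNorm_mul_le (A B : QOp n) : frobNorm (A * B) ≤ ‖A‖ * frobNorm B := by
  refine (pow_le_pow_iff_left₀ (frobNorm_nonneg _)
    (mul_nonneg (norm_nonneg _) (frobNorm_nonneg _)) two_ne_zero).1 ?_
  rw [mul_pow, frobNorm_sq, frobNorm_sq, Fintype.sum_prod_type_right, Fintype.sum_prod_type_right,
    Finset.mul_sum]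
  refine Finset.sum_le_sum fun y _ => ?_
  have h := (Matrix.toEuclideanCLM (n := Fin n → Fin 2) (𝕜 := ℂ) A).le_opNorm
    (WithLp.toLp 2 fun x => B x y)
  have h2 := pow_le_pow_left₀ (norm_nonneg _) h 2
  rw [mul_pow, EuclideanSpace.norm_sq_eq, EuclideanSpace.norm_sq_eq] at h2
  exact h2

lemma isIdealNorm_frobMap : IsIdealNorm (frobMap (n := n)) where
  mul_left A B := by simpa only [norm_frobMap] using frobNorm_mul_le A B
  mul_right A B := by
    rw [norm_frobMap, norm_frobMap, ← frobNorm_conjTranspose, Matrix.conjTranspose_mul, mul_comm,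
      ← frobNorm_conjTranspose B, ← Matrix.l2_opNorm_conjTranspose A]
    exact frobNorm_mul_le _ _

lemma frobNorm_one : frobNorm (1 : QOp n) = Real.sqrt ((2 : ℝ) ^ n) := by
  rw [frobNorm, Matrix.conjTranspose_one, mul_one, Matrix.trace_one]
  congr 1
  rw [Complex.natCast_re]
  simp

lemma frobNorm_le_opNorm (A : QOp n) : frobNorm A ≤ Real.sqrt ((2 : ℝ) ^ n) * opNorm A := by
  have h := frobNorm_mul_le A 1
  rwa [mul_one, frobNorm_one, mul_comm] at h

/-- Pythagoras for operators with trivial mutual Hilbert-Schmidt products. -/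
lemma frobNorm_sum_sq {α : Type*} (s : Finset α) (A : α → QOp n)
    (h : ∀ a ∈ s, ∀ b ∈ s, a ≠ b → (A a * (A b)ᴴ).trace = 0) :
    frobNorm (∑ a ∈ s, A a) ^ 2 = ∑ a ∈ s, frobNorm (A a) ^ 2 := by
  have hsq : ∀ B : QOp n, frobNorm B ^ 2 = (B * Bᴴ).trace.re := fun B => by
    rw [frobNorm_sq, trace_mul_conjTranspose_self]
  rw [hsq, Matrix.conjTranspose_sum, Finset.sum_mul_sum, Matrix.trace_sum, Complex.re_sum]
  refine Finset.sum_congr rfl fun a ha => ?_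
  rw [Matrix.trace_sum, Complex.re_sum, hsq, Finset.sum_eq_single_of_mem a ha]
  intro b hb hab
  rw [h a ha b hb hab.symm, Complex.zero_re]

end Frobenius

/-! ### From a 1-design to the Frobenius norm -/

section OneDesign

/-- The mean of ‖Dψ‖² involves only second moments of ψ, which a 1-design fixes: it equals ‖D‖_F²/d.
Jensen's inequality passes to the mean of ‖Dψ‖. -/
lemma avgError_le (μ : Measure (QState n)) (hμ : IsOneDesign μ) (U U₀ : QOp n) :
    avgError μ U U₀ ≤ 1 / Real.sqrt ((2 : ℝ) ^ n) * frobNorm (U - U₀) := by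
  have := hμ.isProbabilityMeasure
  set D := U - U₀ with hD
  set f : QState n → ℝ := fun ψ => ‖Matrix.toEuclideanCLM (n := Fin n → Fin 2) (𝕜 := ℂ) D ψ‖ with hf
  have hfc : Continuous f := by fun_prop
  have hmem : MemLp f 2 μ := by
    refine MemLp.of_bound hfc.aestronglyMeasurable ‖D‖ ?_
    filter_upwards [hμ.unit] with ψ hψ
    rw [Real.norm_of_nonneg (norm_nonneg _)]
    have h := (Matrix.toEuclideanCLM (n := Fin n → Fin 2) (𝕜 := ℂ) D).le_opNorm ψ
    rwa [hψ, mul_one] at h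
  have havg : avgError μ U U₀ = ∫ ψ, f ψ ∂μ := by
    simp [avgError, hf, hD]
  have hint : ∀ x y : Fin n → Fin 2,
      Integrable (fun ψ : QState n => ψ x * (starRingEnd ℂ) (ψ y)) μ := by
    intro x y
    have hc : Continuous (fun ψ : QState n => ψ x * (starRingEnd ℂ) (ψ y)) := by fun_prop
    refine Integrable.of_bound hc.aestronglyMeasurable 1 ?_
    filter_upwards [hμ.unit] with ψ hψ
    rw [norm_mul, RCLike.norm_conj]
    have h1 := PiLp.norm_apply_le ψ x
    have h2 := PiLp.norm_apply_le ψ y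
    rw [hψ] at h1 h2
    exact mul_le_one₀ h1 (norm_nonneg _) h2
  have hexp : ∀ ψ : QState n, ((f ψ ^ 2 : ℝ) : ℂ) = ∑ x, ∑ y, ∑ y',
      (D x y * (starRingEnd ℂ) (D x y')) * (ψ y * (starRingEnd ℂ) (ψ y')) := by
    intro ψ
    rw [hf, EuclideanSpace.norm_sq_eq, Complex.ofReal_sum]
    refine Finset.sum_congr rfl fun x _ => ?_
    have h1 : Matrix.toEuclideanCLM (n := Fin n → Fin 2) (𝕜 := ℂ) D ψ x = ∑ y, D x y * ψ y := rfl
    rw [h1, ← Complex.normSq_eq_norm_sq, ← Complex.mul_conj, map_sum, Finset.sum_mul_sum]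
    refine Finset.sum_congr rfl fun y _ => Finset.sum_congr rfl fun y' _ => ?_
    rw [map_mul]; ring
  have hsq : ∫ ψ, f ψ ^ 2 ∂μ = frobNorm D ^ 2 / 2 ^ n := by
    have h1 : ((∫ ψ, f ψ ^ 2 ∂μ : ℝ) : ℂ) = ((frobNorm D ^ 2 / 2 ^ n : ℝ) : ℂ) := by
      rw [← integral_complex_ofReal]
      simp only [hexp]
      rw [integral_finsetSum _ fun x _ => integrable_finsetSum _ fun y _ =>
        integrable_finsetSum _ fun y' _ => (hint y y').const_mul _]
      rw [frobNorm_sq, Fintype.sum_prod_type, Finset.sum_div, Complex.ofReal_sum]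
      refine Finset.sum_congr rfl fun x _ => ?_
      rw [integral_finsetSum _ fun y _ =>
        integrable_finsetSum _ fun y' _ => (hint y y').const_mul _, Finset.sum_div,
        Complex.ofReal_sum]
      refine Finset.sum_congr rfl fun y _ => ?_
      rw [integral_finsetSum _ fun y' _ => (hint y y').const_mul _]
      simp only [integral_const_mul, hμ.moment, mul_ite, mul_zero, Finset.sum_ite_eq,
        Finset.mem_univ, if_true]
      rw [Complex.mul_conj, Complex.normSq_eq_norm_sq]
      push_cast
      ring
    exact_mod_cast h1
  -- Nonnegativity of the variance is Jensen's inequality for the square.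
  have hvar := ProbabilityTheory.variance_nonneg f μ
  rw [ProbabilityTheory.variance_eq_sub hmem] at hvar
  have hle : (∫ ψ, f ψ ∂μ) ^ 2 ≤ frobNorm D ^ 2 / 2 ^ n := by
    rw [← hsq]
    have : ∫ ψ, (f ^ 2) ψ ∂μ = ∫ ψ, f ψ ^ 2 ∂μ := rfl
    linarith
  rw [havg]
  refine (Real.le_sqrt_of_sq_le hle).trans (le_of_eq ?_)
  rw [Real.sqrt_div (sq_nonneg _), Real.sqrt_sq (frobNorm_nonneg _)]
  ring

end OneDesign

end ProductFormula

/-! ### Norms of a local Hamiltonian and the trace inequality -/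

namespace KLocalHamiltonian

open ProductFormula
open scoped Matrix.Norms.L2Operator

variable {n k : ℕ} (H : KLocalHamiltonian n k)

lemma opNorm_term_nonneg (j : Fin k → Fin n) : 0 ≤ opNorm (H.term j) := norm_nonneg _

/-- The inner maximum in the induced permutation norm. -/
def permSup (R : Multiset (Fin n)) : ℝ :=
  ⨆ y : Fin k × Fin n, ∑ j' with j' y.1 = y.2 ∧ rest y.1 j' = R, opNorm (H.term j')

lemma sum_le_permSup (R : Multiset (Fin n)) (l : Fin k) (q : Fin n) :
    ∑ j' with j' l = q ∧ rest l j' = R, opNorm (H.term j') ≤ H.permSup R :=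
  le_ciSup (f := fun y : Fin k × Fin n =>
    ∑ j' with j' y.1 = y.2 ∧ rest y.1 j' = R, opNorm (H.term j'))
    (Set.finite_range _).bddAbove (l, q)

/-- This includes n = 0: the index type may be empty, and the real supremum is then 0. -/
lemma permSup_nonneg (R : Multiset (Fin n)) : 0 ≤ H.permSup R :=
  Real.iSup_nonneg fun _ => Finset.sum_nonneg fun j _ => H.opNorm_term_nonneg j

lemma opNorm_le_permSup (l : Fin k) (j : Fin k → Fin n) :
    opNorm (H.term j) ≤ H.permSup (rest l j) := by
  refine le_trans ?_ (H.sum_le_permSup (rest l j) l (j l))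
  exact Finset.single_le_sum (f := fun j => opNorm (H.term j))
    (fun j _ => H.opNorm_term_nonneg j) (by simp)

lemma sum_le_permNormSq (l : Fin k) (q : Fin n) :
    ∑ j with j l = q, opNorm (H.term j) * H.permSup (rest l j) ≤ H.permNormSq :=
  le_ciSup (f := fun x : Fin k × Fin n =>
    ∑ j with j x.1 = x.2, opNorm (H.term j) * H.permSup (rest x.1 j))
    (Set.finite_range _).bddAbove (l, q)

lemma permNormSq_nonneg : 0 ≤ H.permNormSq :=
  Real.iSup_nonneg fun _ => Finset.sum_nonneg fun j _ =>
    mul_nonneg (H.opNorm_term_nonneg j) (H.permSup_nonneg _)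

lemma permNorm_sq : H.permNorm ^ 2 = H.permNormSq := Real.sq_sqrt H.permNormSq_nonneg

lemma permNorm_nonneg : 0 ≤ H.permNorm := Real.sqrt_nonneg _

lemma sum_le_inducedOneNorm (l : Fin k) (q : Fin n) :
    ∑ j with j l = q, opNorm (H.term j) ≤ H.inducedOneNorm :=
  le_ciSup (f := fun x : Fin k × Fin n => ∑ j with j x.1 = x.2, opNorm (H.term j))
    (Set.finite_range _).bddAbove (l, q)

lemma inducedOneNorm_nonneg : 0 ≤ H.inducedOneNorm :=
  Real.iSup_nonneg fun _ => Finset.sum_nonneg fun j _ => H.opNorm_term_nonneg j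

lemma oneNorm_nonneg : 0 ≤ H.oneNorm := Finset.sum_nonneg fun j _ => H.opNorm_term_nonneg j

lemma oneFrobNorm_nonneg : 0 ≤ H.oneFrobNorm := Finset.sum_nonneg fun _ _ => frobNorm_nonneg _

lemma opNorm_le_inducedOneNorm (hk : 1 ≤ k) (j : Fin k → Fin n) :
    opNorm (H.term j) ≤ H.inducedOneNorm := by
  refine le_trans ?_ (H.sum_le_inducedOneNorm ⟨0, hk⟩ (j ⟨0, hk⟩))
  exact Finset.single_le_sum (f := fun j => opNorm (H.term j))
    (fun j _ => H.opNorm_term_nonneg j) (by simp)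

lemma mem_tupleSet {j : Fin k → Fin n} {q : Fin n} : q ∈ tupleSet j ↔ ∃ l, j l = q := by
  simp [tupleSet]

lemma card_tupleSet_le (j : Fin k → Fin n) : (tupleSet j).card ≤ k :=
  Finset.card_image_le.trans (by simp)

lemma not_disjoint_tupleSet {j : Fin k → Fin n} {S : Finset (Fin n)} :
    ¬Disjoint (tupleSet j) S ↔ ∃ l, j l ∈ S := by
  simp [Finset.not_disjoint_iff, tupleSet]

/-- A sum over tuples that meet `S` is bounded through the sums with one entry fixed in `S`. -/
lemma sum_le_of_meets {S : Finset (Fin n)} {J : Finset (Fin k → Fin n)} {f : (Fin k → Fin n) → ℝ}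
    {g : Fin k → (Fin k → Fin n) → ℝ} {B : ℝ} (hg : ∀ l j, 0 ≤ g l j)
    (hf : ∀ j ∈ J, ∃ l, j l ∈ S ∧ f j ≤ g l j) (hB : ∀ l q, q ∈ S → ∑ j with j l = q, g l j ≤ B) :
    ∑ j ∈ J, f j ≤ k * S.card * B := by
  -- Each tuple is charged to every pair (l, q) with j_l = q in S. The weight `g` depends on l
  -- because the permutation norm deletes that entry.
  calc ∑ j ∈ J, f j ≤ ∑ j ∈ J, ∑ l, ∑ q ∈ S, if j l = q then g l j else 0 := by
        refine Finset.sum_le_sum fun j hj => ?_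
        obtain ⟨l, hl, h⟩ := hf j hj
        refine h.trans ?_
        have h0 : ∀ l', 0 ≤ ∑ q ∈ S, if j l' = q then g l' j else 0 := fun l' =>
          Finset.sum_nonneg fun q _ => by split_ifs; exacts [hg _ _, le_rfl]
        refine le_trans ?_ (Finset.single_le_sum (fun l' _ => h0 l') (Finset.mem_univ l))
        simp [hl]
    _ ≤ ∑ j, ∑ l, ∑ q ∈ S, if j l = q then g l j else 0 :=
        Finset.sum_le_univ_sum_of_nonneg fun j => Finset.sum_nonneg fun l _ =>
          Finset.sum_nonneg fun q _ => by split_ifs; exacts [hg _ _, le_rfl]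
    _ = ∑ l, ∑ q ∈ S, ∑ j with j l = q, g l j := by
        rw [Finset.sum_comm]
        refine Finset.sum_congr rfl fun l _ => ?_
        rw [Finset.sum_comm]
        simp only [Finset.sum_filter]
    _ ≤ ∑ _l : Fin k, ∑ _q ∈ S, B :=
        Finset.sum_le_sum fun l _ => Finset.sum_le_sum fun q hq => hB l q hq
    _ = k * S.card * B := by simp [mul_assoc]

lemma sum_meets_le_inducedOneNorm (S : Finset (Fin n)) :
    ∑ j with ¬Disjoint (tupleSet j) S, opNorm (H.term j) ≤ k * S.card * H.inducedOneNorm := by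
  refine sum_le_of_meets (g := fun _ j => opNorm (H.term j)) (fun _ j => H.opNorm_term_nonneg j)
    (fun j hj => ?_) fun l q _ => H.sum_le_inducedOneNorm l q
  obtain ⟨l, hl⟩ := not_disjoint_tupleSet.1 (Finset.mem_filter.1 hj).2
  exact ⟨l, hl, le_rfl⟩

lemma isSelfAdjoint_term (j : Fin k → Fin n) : IsSelfAdjoint (H.term j) :=
  (H.hermitian j).isSelfAdjoint

/-- Commutators with terms that differ outside `S` are orthogonal. -/
lemma frobNorm_lie_sum_sq_le (hH : H.ExactSupport) (i : Fin k → Fin n)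
    (J : Finset (Fin k → Fin n)) :
    frobNorm ⁅H.term i, ∑ j ∈ J, H.term j⁆ ^ 2 ≤ 4 * frobNorm (H.term i) ^ 2 *
      ∑ R : Finset (Fin n), (∑ j ∈ J with ¬Disjoint (tupleSet j) (tupleSet i) ∧
        tupleSet j \ tupleSet i = R, opNorm (H.term j)) ^ 2 := by
  set S := tupleSet i with hS
  set A := H.term i with hA
  -- Terms disjoint from S commute with A and drop out; the others are grouped by the set R of
  -- qubits that they cover outside S.
  have hlie : ⁅A, ∑ j ∈ J, H.term j⁆ = ∑ R : Finset (Fin n),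
      ∑ j ∈ J with ¬Disjoint (tupleSet j) S ∧ tupleSet j \ S = R, ⁅A, H.term j⁆ := by
    have h1 : ⁅A, ∑ j ∈ J, H.term j⁆ = ∑ j ∈ J, ⁅A, H.term j⁆ := by
      simp only [Ring.lie_def, Finset.mul_sum, Finset.sum_mul, Finset.sum_sub_distrib]
    have h2 : ∑ j ∈ J, ⁅A, H.term j⁆ =
        ∑ j ∈ J with ¬Disjoint (tupleSet j) S, ⁅A, H.term j⁆ := by
      rw [Finset.sum_filter]
      refine Finset.sum_congr rfl fun j _ => ?_
      split_ifs with h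
      · have := (H.actsWithin i).commute h.symm (H.actsWithin j)
        rw [Ring.lie_def, this.eq, sub_self]
      · rfl
    rw [h1, h2, ← Finset.sum_fiberwise _ (fun j => tupleSet j \ S)]
    simp only [Finset.filter_filter]
  have hmem : ∀ R : Finset (Fin n),
      ∑ j ∈ J with ¬Disjoint (tupleSet j) S ∧ tupleSet j \ S = R, ⁅A, H.term j⁆ ∈
        pauliSpan {P | pauliSupport P \ S = R} := fun R =>
    Submodule.sum_mem _ fun j hj => by
      have h := lie_mem_pauliSpan (H.actsWithin i) (hH j)
      rw [← hS, (Finset.mem_filter.1 hj).2.2] at h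
      exact h
  -- A Pauli string determines its support outside S, so different R involve disjoint sets of
  -- strings and the groups are orthogonal. The triangle inequality is used only within a group.
  rw [hlie, frobNorm_sum_sq _ _ fun R _ R' _ hR => trace_mul_conjTranspose_eq_zero
    (Set.disjoint_left.2 fun P hP hP' => hR (hP.symm.trans hP')) (hmem R) (hmem R'),
    Finset.mul_sum]
  refine Finset.sum_le_sum fun R _ => ?_
  have h3 : frobNorm (∑ j ∈ J with ¬Disjoint (tupleSet j) S ∧ tupleSet j \ S = R, ⁅A, H.term j⁆) ≤
      2 * frobNorm A *
        ∑ j ∈ J with ¬Disjoint (tupleSet j) S ∧ tupleSet j \ S = R, opNorm (H.term j) := by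
    rw [← norm_frobMap, map_sum, Finset.mul_sum]
    refine (norm_sum_le _ _).trans (Finset.sum_le_sum fun j _ => ?_)
    have h4 := isIdealNorm_frobMap.lie_le' (H.term j) A
    rw [norm_frobMap A] at h4
    rw [opNorm_eq_norm]
    linarith
  refine (pow_le_pow_left₀ (frobNorm_nonneg _) h3 2).trans (le_of_eq ?_)
  ring

/-- The trace inequality, for the commutator with any partial sum of the Hamiltonian. -/
lemma frobNorm_lie_sum_sq_le_permNorm (hH : H.ExactSupport) (i : Fin k → Fin n)
    (J : Finset (Fin k → Fin n)) :
    frobNorm ⁅H.term i, ∑ j ∈ J, H.term j⁆ ^ 2 ≤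
      (4 * (2 * k) ^ k * k ^ 2) * frobNorm (H.term i) ^ 2 * H.permNorm ^ 2 := by
  refine (H.frobNorm_lie_sum_sq_le hH i J).trans ?_
  set S := tupleSet i with hS
  -- Cauchy-Schwarz within a group: its tuples take values in S ∪ R, a set of at most 2k qubits, so
  -- there are at most (2k)^k of them.
  have h1 : ∀ R : Finset (Fin n), (∑ j ∈ J with ¬Disjoint (tupleSet j) S ∧ tupleSet j \ S = R,
      opNorm (H.term j)) ^ 2 ≤ (2 * k) ^ k *
        ∑ j ∈ J with ¬Disjoint (tupleSet j) S ∧ tupleSet j \ S = R, opNorm (H.term j) ^ 2 := by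
    intro R
    refine sq_sum_le_card_mul_sum_sq.trans
      (mul_le_mul_of_nonneg_right ?_ (Finset.sum_nonneg fun _ _ => sq_nonneg _))
    rcases Finset.eq_empty_or_nonempty
      (J.filter fun j => ¬Disjoint (tupleSet j) S ∧ tupleSet j \ S = R) with h | ⟨j₀, h₀⟩
    · rw [h]; simp
    · have hR : R.card ≤ k := by
        rw [← (Finset.mem_filter.1 h₀).2.2]
        exact (Finset.card_le_card Finset.sdiff_subset).trans (card_tupleSet_le j₀)
      have hsub : (J.filter fun j => ¬Disjoint (tupleSet j) S ∧ tupleSet j \ S = R) ⊆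
          Fintype.piFinset fun _ : Fin k => S ∪ R := by
        intro j hj
        rw [Fintype.mem_piFinset]
        intro l
        rw [← (Finset.mem_filter.1 hj).2.2, Finset.union_sdiff_self_eq_union, Finset.mem_union]
        exact Or.inr (mem_tupleSet.2 ⟨l, rfl⟩)
      have h2 := Finset.card_le_card hsub
      rw [Fintype.card_piFinset_const] at h2
      have h3 : (S ∪ R).card ≤ 2 * k :=
        (Finset.card_union_le _ _).trans (by have : S.card ≤ k := card_tupleSet_le i; omega)
      exact_mod_cast h2.trans (Nat.pow_le_pow_left h3 k)
  have h2 : ∑ R : Finset (Fin n), ∑ j ∈ J with ¬Disjoint (tupleSet j) S ∧ tupleSet j \ S = R,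
      opNorm (H.term j) ^ 2 = ∑ j ∈ J with ¬Disjoint (tupleSet j) S, opNorm (H.term j) ^ 2 := by
    rw [← Finset.sum_fiberwise _ (fun j => tupleSet j \ S)]
    simp only [Finset.filter_filter]
  have h3 : ∑ j ∈ J with ¬Disjoint (tupleSet j) S, opNorm (H.term j) ^ 2 ≤
      k * S.card * H.permNorm ^ 2 := by
    rw [permNorm_sq]
    refine sum_le_of_meets (g := fun l j => opNorm (H.term j) * H.permSup (rest l j))
      (fun l j => mul_nonneg (H.opNorm_term_nonneg j) (H.permSup_nonneg _))
      (fun j hj => ?_) fun l q _ => H.sum_le_permNormSq l q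
    obtain ⟨l, hl⟩ := not_disjoint_tupleSet.1 (Finset.mem_filter.1 hj).2
    refine ⟨l, hl, ?_⟩
    -- Only the diagonal part of the permutation norm is needed: j itself occurs in the inner
    -- maximum, so ‖H_j‖² is at most ‖H_j‖ times that maximum.
    rw [sq]
    exact mul_le_mul_of_nonneg_left (H.opNorm_le_permSup l j) (H.opNorm_term_nonneg j)
  have h4 : ∑ R : Finset (Fin n), (∑ j ∈ J with ¬Disjoint (tupleSet j) S ∧ tupleSet j \ S = R,
      opNorm (H.term j)) ^ 2 ≤ (2 * k) ^ k * (k * k * H.permNorm ^ 2) := by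
    refine (Finset.sum_le_sum fun R _ => h1 R).trans ?_
    rw [← Finset.mul_sum, h2]
    refine mul_le_mul_of_nonneg_left (h3.trans ?_) (by positivity)
    have : ((tupleSet i).card : ℝ) ≤ k := by exact_mod_cast card_tupleSet_le i
    gcongr
  calc _ ≤ 4 * frobNorm (H.term i) ^ 2 * ((2 * k) ^ k * (k * k * H.permNorm ^ 2)) := by gcongr
    _ = _ := by ring

/-- Just one entry lies in S and no entry is repeated, so deleting it leaves each qubit outside S
once. This identifies the groups R with the permutation classes in the permutation norm. -/
lemma rest_eq_of_injective {S : Finset (Fin n)} {j : Fin k → Fin n} (hj : Function.Injective j)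
    (hS : (tupleSet j ∩ S).card = 1) {l : Fin k} (hl : j l ∈ S) :
    rest l j = (tupleSet j \ S).val := by
  have h : tupleSet j \ S = (Finset.univ.erase l).image j := by
    obtain ⟨q, hq⟩ := Finset.card_eq_one.1 hS
    have hmem : ∀ a, j a ∈ S → j a = q := fun a ha => by
      have : j a ∈ tupleSet j ∩ S := Finset.mem_inter.2 ⟨mem_tupleSet.2 ⟨a, rfl⟩, ha⟩
      rwa [hq, Finset.mem_singleton] at this
    ext x
    simp only [Finset.mem_sdiff, mem_tupleSet, Finset.mem_image, Finset.mem_erase,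
      Finset.mem_univ, and_true]
    constructor
    · rintro ⟨⟨a, rfl⟩, ha⟩
      exact ⟨a, fun h => ha (h ▸ hl), rfl⟩
    · rintro ⟨a, ha, rfl⟩
      exact ⟨⟨a, rfl⟩, fun h => ha (hj ((hmem a h).trans (hmem l hl).symm))⟩
  rw [h, Finset.image_val_of_injOn hj.injOn, rest]

/-- The trace inequality with explicit constant, for overlaps in a single qubit. -/
lemma frobNorm_lie_sum_sq_le_of_single_overlap (hH : H.ExactSupport) (i : Fin k → Fin n) :
    frobNorm ⁅H.term i,
        ∑ j with Function.Injective j ∧ (tupleSet j ∩ tupleSet i).card = 1, H.term j⁆ ^ 2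
      ≤ 4 * (k : ℝ) ^ 4 * frobNorm (H.term i) ^ 2 * H.permNorm ^ 2 := by
  refine (H.frobNorm_lie_sum_sq_le hH i _).trans ?_
  set S := tupleSet i with hS
  set J : Finset (Fin k → Fin n) :=
    {j | Function.Injective j ∧ (tupleSet j ∩ S).card = 1} with hJ
  have hcard : (S.card : ℝ) ≤ k := by exact_mod_cast card_tupleSet_le i
  have hrest : ∀ j ∈ J, ∀ l, j l ∈ S → rest l j = (tupleSet j \ S).val := fun j hj l hl =>
    rest_eq_of_injective (Finset.mem_filter.1 hj).2.1 (Finset.mem_filter.1 hj).2.2 hl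
  -- For each of the k positions and each of the at most k qubits of S, the tuples of group R fall
  -- under a single inner sum of the permutation norm.
  have h1 : ∀ R : Finset (Fin n),
      ∑ j ∈ J with ¬Disjoint (tupleSet j) S ∧ tupleSet j \ S = R, opNorm (H.term j) ≤
        k * k * H.permSup R.val := by
    intro R
    have h2 := sum_le_of_meets (S := S)
      (J := J.filter fun j => ¬Disjoint (tupleSet j) S ∧ tupleSet j \ S = R)
      (f := fun j => opNorm (H.term j))
      (g := fun l j => if rest l j = R.val then opNorm (H.term j) else 0) (B := H.permSup R.val)
      (fun l j => by split_ifs; exacts [H.opNorm_term_nonneg j, le_rfl])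
      (fun j hj => by
        obtain ⟨hjJ, hd, hjR⟩ := Finset.mem_filter.1 hj
        obtain ⟨l, hl⟩ := not_disjoint_tupleSet.1 hd
        refine ⟨l, hl, ?_⟩
        rw [if_pos (by rw [hrest j hjJ l hl, hjR])])
      (fun l q _ => by
        rw [← Finset.sum_filter, Finset.filter_filter]
        exact H.sum_le_permSup R.val l q)
    have := H.permSup_nonneg R.val
    exact h2.trans (by gcongr)
  have h2 : ∀ R : Finset (Fin n), (∑ j ∈ J with ¬Disjoint (tupleSet j) S ∧ tupleSet j \ S = R,
      opNorm (H.term j)) ^ 2 ≤ ∑ j ∈ J with ¬Disjoint (tupleSet j) S ∧ tupleSet j \ S = R,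
        k * k * (opNorm (H.term j) * H.permSup (tupleSet j \ S).val) := by
    intro R
    have h3 : ∑ j ∈ J with ¬Disjoint (tupleSet j) S ∧ tupleSet j \ S = R,
        k * k * (opNorm (H.term j) * H.permSup (tupleSet j \ S).val) =
        (∑ j ∈ J with ¬Disjoint (tupleSet j) S ∧ tupleSet j \ S = R, opNorm (H.term j)) *
          (k * k * H.permSup R.val) := by
      rw [Finset.sum_mul]
      refine Finset.sum_congr rfl fun j hj => ?_
      rw [(Finset.mem_filter.1 hj).2.2]
      ring
    rw [h3, sq]
    -- Of the two factors in the square, one is bounded by k² times the inner maximum and the other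
    -- is kept as a sum; a second k² comes from the choice of overlap in `h4`.
    exact mul_le_mul_of_nonneg_left (h1 R) (Finset.sum_nonneg fun j _ => H.opNorm_term_nonneg j)
  have h3 : ∑ R : Finset (Fin n), ∑ j ∈ J with ¬Disjoint (tupleSet j) S ∧ tupleSet j \ S = R,
      k * k * (opNorm (H.term j) * H.permSup (tupleSet j \ S).val) =
      k * k * ∑ j ∈ J with ¬Disjoint (tupleSet j) S,
        opNorm (H.term j) * H.permSup (tupleSet j \ S).val := by
    rw [Finset.mul_sum, ← Finset.sum_fiberwise _ (fun j => tupleSet j \ S)]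
    simp only [Finset.filter_filter]
  have h4 : ∑ j ∈ J with ¬Disjoint (tupleSet j) S,
      opNorm (H.term j) * H.permSup (tupleSet j \ S).val ≤ k * S.card * H.permNorm ^ 2 := by
    rw [permNorm_sq]
    refine sum_le_of_meets (g := fun l j => opNorm (H.term j) * H.permSup (rest l j))
      (fun l j => mul_nonneg (H.opNorm_term_nonneg j) (H.permSup_nonneg _))
      (fun j hj => ?_) fun l q _ => H.sum_le_permNormSq l q
    obtain ⟨hjJ, hd⟩ := Finset.mem_filter.1 hj
    obtain ⟨l, hl⟩ := not_disjoint_tupleSet.1 hd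
    exact ⟨l, hl, by rw [hrest j hjJ l hl]⟩
  have h5 : ∑ R : Finset (Fin n), (∑ j ∈ J with ¬Disjoint (tupleSet j) S ∧ tupleSet j \ S = R,
      opNorm (H.term j)) ^ 2 ≤ k * k * (k * k * H.permNorm ^ 2) := by
    refine (Finset.sum_le_sum fun R _ => h2 R).trans ?_
    rw [h3]
    refine mul_le_mul_of_nonneg_left (h4.trans (by gcongr)) (by positivity)
  calc _ ≤ 4 * frobNorm (H.term i) ^ 2 * (k * k * (k * k * H.permNorm ^ 2)) := by gcongr
    _ = _ := by ring

/-! ### Counting tuples when all terms have norm at most one -/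

section Counting

lemma card_filter_apply_eq_le (l : Fin k) (q : Fin n) :
    (Finset.univ.filter fun j : Fin k → Fin n => j l = q).card ≤ n ^ (k - 1) := by
  have hsub : (Finset.univ.filter fun j : Fin k → Fin n => j l = q) ⊆
      Fintype.piFinset fun a : Fin k => if a = l then {q} else Finset.univ := by
    intro j hj
    rw [Fintype.mem_piFinset]
    intro a
    split_ifs with h
    · rw [h, Finset.mem_singleton]; exact (Finset.mem_filter.1 hj).2
    · exact Finset.mem_univ _
  refine (Finset.card_le_card hsub).trans (le_of_eq ?_)
  rw [Fintype.card_piFinset, ← Finset.mul_prod_erase _ _ (Finset.mem_univ l), if_pos rfl,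
    Finset.card_singleton, one_mul, Finset.prod_congr rfl (g := fun _ => n) fun a ha => by
      rw [if_neg (Finset.ne_of_mem_erase ha)]; simp]
  simp

lemma card_rest_le (l : Fin k) (j : Fin k → Fin n) : (rest l j).card ≤ k := by
  rw [rest, Multiset.card_map]
  exact (Finset.card_le_univ _).trans (by simp)

lemma oneNorm_le (h : ∀ j, opNorm (H.term j) ≤ 1) : H.oneNorm ≤ (n : ℝ) ^ k := by
  refine (Finset.sum_le_sum fun j _ => h j).trans ?_
  simp

lemma oneFrobNorm_le (h : ∀ j, opNorm (H.term j) ≤ 1) :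
    1 / Real.sqrt ((2 : ℝ) ^ n) * H.oneFrobNorm ≤ (n : ℝ) ^ k := by
  refine le_trans ?_ (H.oneNorm_le h)
  have hs : 0 < Real.sqrt ((2 : ℝ) ^ n) := by positivity
  rw [one_div, inv_mul_le_iff₀ hs, oneNorm, Finset.mul_sum]
  exact Finset.sum_le_sum fun j _ => frobNorm_le_opNorm _

lemma inducedOneNorm_le (h : ∀ j, opNorm (H.term j) ≤ 1) :
    H.inducedOneNorm ≤ (n : ℝ) ^ (k - 1) := by
  refine Real.iSup_le (fun x => ?_) (by positivity)
  refine (Finset.sum_le_sum fun j _ => h j).trans ?_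
  rw [Finset.sum_const, nsmul_one]
  exact_mod_cast card_filter_apply_eq_le x.1 x.2

/-- Fixing one entry and the multiset of the others confines all entries to at most k + 1 qubits, so
the number of tuples does not depend on n. -/
lemma permSup_le (h : ∀ j, opNorm (H.term j) ≤ 1) {R : Multiset (Fin n)} (hR : R.card ≤ k) :
    H.permSup R ≤ ((k : ℝ) + 1) ^ k := by
  refine Real.iSup_le (fun y => ?_) (by positivity)
  refine (Finset.sum_le_sum fun j _ => h j).trans ?_
  rw [Finset.sum_const, nsmul_one]
  have hsub : (Finset.univ.filter fun j : Fin k → Fin n => j y.1 = y.2 ∧ rest y.1 j = R) ⊆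
      Fintype.piFinset fun _ : Fin k => insert y.2 R.toFinset := by
    intro j hj
    obtain ⟨h1, h2⟩ := (Finset.mem_filter.1 hj).2
    rw [Fintype.mem_piFinset]
    intro a
    rw [Finset.mem_insert, Multiset.mem_toFinset, ← h2]
    by_cases ha : a = y.1
    · exact Or.inl (ha ▸ h1)
    · exact Or.inr (Multiset.mem_map_of_mem j (Finset.mem_erase.2 ⟨ha, Finset.mem_univ a⟩))
  have h1 := Finset.card_le_card hsub
  rw [Fintype.card_piFinset_const] at h1
  have h2 : (insert y.2 R.toFinset).card ≤ k + 1 :=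
    (Finset.card_insert_le _ _).trans (by have := Multiset.toFinset_card_le R; omega)
  exact_mod_cast h1.trans (Nat.pow_le_pow_left h2 k)

/-- The inner maximum is O(1), so only the n^(k-1) free choices in the outer sum count; the square
root halves the exponent. -/
lemma permNorm_le (hk : 1 ≤ k) (h : ∀ j, opNorm (H.term j) ≤ 1) :
    H.permNorm ≤ Real.sqrt (((k : ℝ) + 1) ^ k) * (n : ℝ) ^ (((k : ℝ) - 1) / 2) := by
  have h1 : H.permNormSq ≤ ((k : ℝ) + 1) ^ k * (n : ℝ) ^ (k - 1) := by
    refine Real.iSup_le (fun x => ?_) (by positivity)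
    calc ∑ j with j x.1 = x.2, opNorm (H.term j) * H.permSup (rest x.1 j)
        ≤ ∑ j : Fin k → Fin n with j x.1 = x.2, ((k : ℝ) + 1) ^ k :=
          Finset.sum_le_sum fun j _ => by
            have h2 := H.permSup_le h (card_rest_le x.1 j)
            have h3 := H.permSup_nonneg (rest x.1 j)
            exact (mul_le_of_le_one_left h3 (h j)).trans h2
      _ ≤ _ := by
          rw [Finset.sum_const, nsmul_eq_mul, mul_comm]
          refine mul_le_mul_of_nonneg_left ?_ (by positivity)
          exact_mod_cast card_filter_apply_eq_le x.1 x.2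
  refine (Real.sqrt_le_sqrt h1).trans (le_of_eq ?_)
  rw [Real.sqrt_mul (by positivity)]
  congr 1
  rw [Real.sqrt_eq_rpow, ← Real.rpow_natCast, ← Real.rpow_mul (Nat.cast_nonneg n),
    Nat.cast_sub hk]
  congr 1
  push_cast
  ring

end Counting

end KLocalHamiltonian

namespace ProductFormula

/-! ### Two exponents, and the passage to r steps -/

section TwoTerms

variable {𝓐 : Type*} [CStarAlgebra 𝓐] {V : Type*} [NormedAddCommGroup V] [NormedSpace ℂ V]

lemma taylorTerm_one (X x : 𝓐) : taylorTerm X 1 x = -Complex.I • ⁅X, x⁆ := by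
  simp [taylorTerm, derivation_apply]

lemma norm_taylorTerm_one (ι : 𝓐 →L[ℂ] V) (X x : 𝓐) : ‖ι (taylorTerm X 1 x)‖ = ‖ι ⁅X, x⁆‖ := by
  simp [taylorTerm_one, norm_smul]

lemma norm_taylorTerm_two (ι : 𝓐 →L[ℂ] V) (X x : 𝓐) :
    ‖ι (taylorTerm X 2 x)‖ = ‖ι ⁅X, ⁅X, x⁆⁆‖ / 2 := by
  have h : ∀ z : 𝓐, derivation X (derivation X z) = -⁅X, ⁅X, z⁆⁆ := fun z => by
    simp only [derivation_apply, Ring.lie_def, mul_smul_comm, smul_mul_assoc, ← smul_sub, smul_smul]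
    simp
  simp only [taylorTerm, pow_two, LinearMap.smul_apply, Module.End.mul_apply, h, map_smul, map_neg,
    norm_smul, norm_neg]
  simp [Nat.factorial]
  ring

/-- The error of the first-order formula for two exponentials. -/
lemma IsIdealNorm.trotter_two_le {ι : 𝓐 →L[ℂ] V} (hι : IsIdealNorm ι) {A B : 𝓐}
    (hA : IsSelfAdjoint A) (hB : IsSelfAdjoint B) {t : ℝ} (ht : 0 ≤ t) :
    ‖ι (evo A t * evo B t - evo (A + B) t)‖ ≤ ‖ι ⁅A, B⁆‖ * t ^ 2 := by
  have h := hι.prodEvo_sub_evo_le (σ := [A, B]) le_rfl (by simp [hA, hB])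
    (by simpa using hA.add hB) (hasOrder_one [A, B]) ht
  have h1 : nestedSum [A, B] 1 (fun x => ‖ι x‖) = ‖ι ⁅A, B⁆‖ := by
    simp [nestedSum, Finset.sum_range_succ, norm_taylorTerm_one]
  rw [h1] at h
  simpa using h

/-- The error of the second-order formula for two exponentials. -/
lemma IsIdealNorm.strang_le {ι : 𝓐 →L[ℂ] V} (hι : IsIdealNorm ι) {A B : 𝓐}
    (hA : IsSelfAdjoint A) (hB : IsSelfAdjoint B) {t : ℝ} (ht : 0 ≤ t) :
    ‖ι (evo ((2⁻¹ : ℝ) • A) t * (evo B t * evo ((2⁻¹ : ℝ) • A) t) - evo (A + B) t)‖ ≤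
      (‖ι ⁅A, ⁅A, B⁆⁆‖ + ‖ι ⁅B, ⁅B, A⁆⁆‖) * t ^ 3 := by
  have hA' : IsSelfAdjoint ((2⁻¹ : ℝ) • A) := (IsSelfAdjoint.all _).smul hA
  have hsum : ([(2⁻¹ : ℝ) • A, B, (2⁻¹ : ℝ) • A]).sum = A + B := by
    have : (2⁻¹ : ℝ) • A + (2⁻¹ : ℝ) • A = A := by rw [← add_smul]; norm_num
    simp only [List.sum_cons, List.sum_nil, add_zero]
    rw [add_comm B, ← add_assoc, this]
  have h2 := hasOrder_two (σ := [(2⁻¹ : ℝ) • A, B, (2⁻¹ : ℝ) • A]) rfl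
  rw [hsum] at h2
  have h := hι.prodEvo_sub_evo_le one_le_two (by simp [hA', hB]) (hA.add hB) h2 ht
  simp only [prodEvo_cons, prodEvo_nil, mul_one] at h
  refine h.trans (mul_le_mul_of_nonneg_right ?_ (by positivity))
  have hs : ∀ (c : ℝ) (x y : 𝓐), ⁅c • x, y⁆ = c • ⁅x, y⁆ ∧ ⁅x, c • y⁆ = c • ⁅x, y⁆ := fun c x y => by
    simp [Ring.lie_def, smul_sub]
  have hn : ∀ (c : ℝ) (x : 𝓐), ‖ι (c • x)‖ = |c| * ‖ι x‖ := fun c x => by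
    rw [← Complex.coe_smul, map_smul, norm_smul, Complex.norm_real, Real.norm_eq_abs]
  have h3 : ‖ι ⁅A, ⁅B, A⁆⁆‖ = ‖ι ⁅A, ⁅A, B⁆⁆‖ := by
    rw [← norm_neg, ← map_neg]
    congr 2
    simp only [Ring.lie_def]
    noncomm_ring
  have h4 : ‖ι (taylorTerm ((2⁻¹ : ℝ) • A) 1 (taylorTerm B 1 ((2⁻¹ : ℝ) • A)))‖ =
      ‖ι ⁅A, ⁅A, B⁆⁆‖ / 4 := by
    rw [norm_taylorTerm_one, taylorTerm_one]
    have h5 : ∀ x y : 𝓐, ⁅x, -Complex.I • y⁆ = -Complex.I • ⁅x, y⁆ := fun x y => by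
      simp only [Ring.lie_def, mul_smul_comm, smul_mul_assoc, smul_sub]
    rw [h5, map_smul, norm_smul, norm_neg, Complex.norm_I, one_mul, (hs _ _ _).1, (hs _ _ _).2,
      (hs _ _ _).2, hn, hn, h3, abs_of_pos (by norm_num)]
    ring
  have h5 : ‖ι (taylorTerm B 2 ((2⁻¹ : ℝ) • A))‖ = ‖ι ⁅B, ⁅B, A⁆⁆‖ / 4 := by
    rw [norm_taylorTerm_two, (hs _ _ _).2, (hs _ _ _).2, hn, abs_of_pos (by norm_num)]
    ring
  have h6 : ‖ι (taylorTerm ((2⁻¹ : ℝ) • A) 2 B)‖ = ‖ι ⁅A, ⁅A, B⁆⁆‖ / 8 := by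
    rw [norm_taylorTerm_two, (hs _ _ _).1, (hs _ _ _).1, (hs _ _ _).2, hn, hn,
      abs_of_pos (by norm_num)]
    ring
  have h7 : ‖ι (taylorTerm ((2⁻¹ : ℝ) • A) 2 ((2⁻¹ : ℝ) • A))‖ = 0 := by
    rw [norm_taylorTerm_two, Ring.lie_def ((2⁻¹ : ℝ) • A) ((2⁻¹ : ℝ) • A), sub_self]
    simp [Ring.lie_def]
  -- The surviving terms of depth two are: B twice on the right A/2; A/2 then outside B on the right
  -- A/2; and A/2 twice on B. The halves and the 1/2! yield the weights 1/4, 1/4 and 1/8.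
  have h1 : nestedSum [(2⁻¹ : ℝ) • A, B, (2⁻¹ : ℝ) • A] 2 (fun x => ‖ι x‖) =
      ‖ι ⁅B, ⁅B, A⁆⁆‖ / 4 + ‖ι ⁅A, ⁅A, B⁆⁆‖ / 4 + ‖ι ⁅A, ⁅A, B⁆⁆‖ / 8 := by
    generalize (2⁻¹ : ℝ) • A = A' at h4 h5 h6 h7 ⊢
    simp [nestedSum, Finset.sum_range_succ, taylorTerm_zero, h4, h5, h6, h7]
  rw [h1]
  have := norm_nonneg (ι ⁅A, ⁅A, B⁆⁆)
  have := norm_nonneg (ι ⁅B, ⁅B, A⁆⁆)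
  linarith

/-- Passing from one step to `r` steps. -/
lemma IsIdealNorm.steps_le {ι : 𝓐 →L[ℂ] V} (hι : IsIdealNorm ι) {σ : List 𝓐} {H : 𝓐} {p : ℕ}
    (hσ : ∀ X ∈ σ, IsSelfAdjoint X) (hH : IsSelfAdjoint H) {B : ℝ}
    (h : ∀ t, 0 ≤ t → ‖ι (prodEvo σ t - evo H t)‖ ≤ B * t ^ (p + 1)) {t : ℝ} (ht : 0 ≤ t)
    {r : ℕ} (hr : 1 ≤ r) :
    ‖ι (prodEvo σ (t / r) ^ r - evo H t)‖ ≤ t ^ (p + 1) / r ^ p * B := by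
  have hr0 : (r : ℝ) ≠ 0 := by positivity
  have h1 : evo H t = evo H (t / r) ^ r := by
    rw [evo_nsmul, mul_div_cancel₀ t hr0]
  rw [h1]
  refine (hι.pow_sub_pow_le (prodEvo_mem_unitary hσ _) (evo_mem_unitary hH _) r).trans ?_
  calc (r : ℝ) * _ ≤ r * (B * (t / r) ^ (p + 1)) := by gcongr; exact h _ (by positivity)
    _ = _ := by rw [div_pow, pow_succ (r : ℝ)]; field_simp

end TwoTerms

end ProductFormula

namespace KLocalHamiltonian

open ProductFormula
open scoped Matrix.Norms.L2Operator

variable {n k : ℕ} (H : KLocalHamiltonian n k)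

lemma isSelfAdjoint_total : IsSelfAdjoint H.total :=
  isSelfAdjoint_sum _ fun j _ => H.isSelfAdjoint_term j

/-! ### Formulas of any order for a local Hamiltonian -/

section HighOrder

/-- A list of exponents that are multiples of the terms of `H`, with total weight `K` per term. -/
structure IsStageList (σ : List (QOp n)) (K : ℝ) : Prop where
  eq_smul : ∀ X ∈ σ, ∃ (a : ℝ) (j : Fin k → Fin n), X = a • H.term j
  weight : ∀ φ : QOp n → ℝ, (∀ (a : ℝ) X, φ (a • X) = |a| * φ X) →
    (σ.map φ).sum = K * ∑ j, φ (H.term j)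

variable {H}

lemma IsStageList.isSelfAdjoint {σ : List (QOp n)} {K : ℝ} (h : H.IsStageList σ K) :
    ∀ X ∈ σ, IsSelfAdjoint X := by
  intro X hX
  obtain ⟨a, j, rfl⟩ := h.eq_smul X hX
  exact (IsSelfAdjoint.all a).smul (H.isSelfAdjoint_term j)

lemma IsStageList.suzukiStep {σ : List (QOp n)} {K : ℝ} (h : H.IsStageList σ K) (c : ℝ) :
    H.IsStageList (suzukiStep c σ) ((4 * |c| + |1 - 4 * c|) * K) where
  eq_smul X hX := by
    have h1 : ∃ b : ℝ, ∃ Y ∈ σ, b • Y = X := by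
      simp only [ProductFormula.suzukiStep, List.mem_append, List.mem_map] at hX
      rcases hX with h | h | h | h | h <;> exact ⟨_, h⟩
    obtain ⟨b, Y, hY, rfl⟩ := h1
    obtain ⟨a, j, rfl⟩ := h.eq_smul Y hY
    exact ⟨b * a, j, by rw [smul_smul]⟩
  weight φ hφ := by rw [sum_map_suzukiStep c σ hφ, h.weight φ hφ, mul_assoc]

/-- Operators on at most `(m + 1) k` qubits. -/
def IsLocal (k m : ℕ) (x : QOp n) : Prop := ∃ S : Finset (Fin n), S.card ≤ (m + 1) * k ∧ ActsWithin S x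

lemma _root_.ProductFormula.ActsWithin.taylorTerm {S T : Finset (Fin n)} {X x : QOp n}
    (hX : ActsWithin T X) (hx : ActsWithin S x) (j : ℕ) : ActsWithin (T ∪ S) (taylorTerm X j x) := by
  refine Submodule.smul_mem _ _ ?_
  induction j with
  | zero => exact hx.mono Finset.subset_union_right
  | succ j ih =>
    rw [pow_succ', Module.End.mul_apply, derivation_apply, Ring.lie_def]
    have h1 := ActsWithin.mul hX ih
    have h2 := ActsWithin.mul ih hX
    rw [← Finset.union_assoc, Finset.union_self] at h1
    rw [Finset.union_comm, ← Finset.union_assoc, Finset.union_self] at h2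
    exact Submodule.smul_mem _ _ (Submodule.sub_mem _ h1 h2)

lemma IsStageList.isLocal {σ : List (QOp n)} {K : ℝ} (h : H.IsStageList σ K) {X : QOp n}
    (hX : X ∈ σ) : IsLocal k 0 X := by
  obtain ⟨a, j, rfl⟩ := h.eq_smul X hX
  refine ⟨tupleSet j, by simpa using card_tupleSet_le j, ?_⟩
  rw [← Complex.coe_smul]
  exact Submodule.smul_mem _ _ (H.actsWithin j)

/-- Repeated commutators with the same `X` adjoin only the qubits of `X`, at most k of them however
large j is; the index m + j is generous but matches the depth. -/
lemma IsLocal.taylorTerm {X x : QOp n} {m : ℕ} (hX : IsLocal k 0 X) (hx : IsLocal k m x) (j : ℕ) :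
    IsLocal k (m + j) (taylorTerm X j x) := by
  rcases j with _ | j
  · rwa [taylorTerm_zero]
  obtain ⟨T, hT, hX⟩ := hX
  obtain ⟨S, hS, hx⟩ := hx
  refine ⟨T ∪ S, (Finset.card_union_le _ _).trans ?_, ProductFormula.ActsWithin.taylorTerm hX hx _⟩
  calc T.card + S.card ≤ (0 + 1) * k + (m + 1) * k := add_le_add hT hS
    _ = (m + 1 + 1) * k := by ring
    _ ≤ _ := Nat.mul_le_mul_right k (by omega)

open Classical in
lemma IsStageList.sum_not_commute_le {σ : List (QOp n)} {K : ℝ} (h : H.IsStageList σ K)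
    (hK : 0 ≤ K) (m : ℕ) (x : QOp n) (hx : IsLocal k m x) :
    (σ.map fun X => if Commute X x then 0 else ‖X‖).sum ≤
      K * (k * ((m + 1) * k)) * H.inducedOneNorm := by
  obtain ⟨S, hS, hx⟩ := hx
  -- The weight identity applies to the norm set to zero on operators commuting with `x`: nonzero
  -- scalars do not affect commutation, so this function is absolutely homogeneous.
  rw [h.weight _ fun a X => ?_]
  · rw [mul_assoc]
    refine mul_le_mul_of_nonneg_left ?_ hK
    calc ∑ j, (if Commute (H.term j) x then 0 else ‖H.term j‖)
        ≤ ∑ j with ¬Disjoint (tupleSet j) S, opNorm (H.term j) := by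
          rw [Finset.sum_filter]
          refine Finset.sum_le_sum fun j _ => ?_
          by_cases hd : Disjoint (tupleSet j) S
          · rw [if_pos ((H.actsWithin j).commute hd hx), if_neg (not_not.2 hd)]
          · rw [if_pos hd]
            split_ifs
            exacts [norm_nonneg _, le_rfl]
      _ ≤ k * S.card * H.inducedOneNorm := H.sum_meets_le_inducedOneNorm S
      _ ≤ k * ((m + 1) * k) * H.inducedOneNorm := by
          have h1 := H.inducedOneNorm_nonneg
          have h2 : (S.card : ℝ) ≤ (m + 1) * k := by exact_mod_cast hS
          gcongr
  · rcases eq_or_ne a 0 with rfl | ha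
    · simp
    · have : Commute (a • X) x ↔ Commute X x := by
        constructor
        · intro hc
          have := hc.smul_left a⁻¹
          rwa [smul_smul, inv_mul_cancel₀ ha, one_smul] at this
        · exact fun hc => hc.smul_left a
      simp only [this]
      split_ifs
      · simp
      · rw [norm_smul, Real.norm_eq_abs]

/-- The constant of `IsStageList.error_le`. -/
def stageConst (k : ℕ) (K : ℝ) (p : ℕ) : ℝ :=
  nestedConst (fun m => K * (k * ((m + 1) * k))) p * K

lemma stageConst_nonneg (k : ℕ) {K : ℝ} (hK : 0 ≤ K) (p : ℕ) : 0 ≤ stageConst k K p :=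
  mul_nonneg (nestedConst_nonneg (fun m => by positivity) p) hK

/-- The error of a product formula of order `p`. -/
theorem IsStageList.error_le {V : Type*} [NormedAddCommGroup V] [NormedSpace ℂ V]
    {ι : QOp n →L[ℂ] V} (hι : IsIdealNorm ι) {σ : List (QOp n)} {K : ℝ} (h : H.IsStageList σ K)
    (hK : 0 ≤ K) {p : ℕ} (hp : 1 ≤ p) (hord : HasOrder σ H.total p) {t : ℝ} (ht : 0 ≤ t)
    {r : ℕ} (hr : 1 ≤ r) :
    ‖ι (prodEvo σ (t / r) ^ r - evo H.total t)‖ ≤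
      stageConst k K p * (t ^ (p + 1) / r ^ p * ((∑ j, ‖ι (H.term j)‖) * H.inducedOneNorm ^ p)) := by
  have h1 := hι.nestedSum_le (P := IsLocal k) (σ := σ) (fun X hX => h.isLocal hX)
    (fun X hX m j x hx => (h.isLocal hX).taylorTerm hx j)
    (c := fun m => K * (k * ((m + 1) * k))) (fun m => by positivity) H.inducedOneNorm_nonneg
    (h.sum_not_commute_le hK) p
  rw [h.weight (fun X => ‖ι X‖) fun a X => by
    rw [← Complex.coe_smul, map_smul, norm_smul, Complex.norm_real, Real.norm_eq_abs]] at h1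
  refine (hι.steps_le h.isSelfAdjoint H.isSelfAdjoint_total (p := p) (fun s hs =>
    (hι.prodEvo_sub_evo_le hp h.isSelfAdjoint H.isSelfAdjoint_total hord hs).trans
      (mul_le_mul_of_nonneg_right h1 (by positivity))) ht hr).trans (le_of_eq ?_)
  rw [stageConst]
  ring

end HighOrder

/-! ### The product formulas as lists of exponents -/

section Formulas

/-- The exponents of the second-order formula. -/
def strangList (l : List (QOp n)) : List (QOp n) :=
  (l.map fun X => (2⁻¹ : ℝ) • X) ++ (l.map fun X => (2⁻¹ : ℝ) • X).reverse

lemma reverse_strangList (l : List (QOp n)) : (strangList l).reverse = strangList l := by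
  simp [strangList]

lemma sum_strangList (l : List (QOp n)) : (strangList l).sum = l.sum := by
  rw [strangList, List.sum_append, List.sum_reverse, ← List.smul_sum, ← add_smul]
  norm_num

lemma pf1_eq {L : ℕ} (A : Fin L → QOp n) (t : ℝ) : pf1 A t = prodEvo (List.ofFn A) t := by
  rw [pf1, prodEvo, List.map_ofFn]
  rfl

lemma pf2_eq {L : ℕ} (A : Fin L → QOp n) (t : ℝ) :
    pf2 A t = prodEvo (strangList (List.ofFn A)) t := by
  have h : (List.ofFn fun l => evolution (A l) (t / 2)) =
      ((List.ofFn A).map fun X => (2⁻¹ : ℝ) • X).map fun X => evo X t := by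
    rw [List.map_ofFn, List.map_ofFn]
    congr 1
    funext l
    simp only [Function.comp, evo_smul, evolution_eq_evo]
    congr 1; ring
  rw [pf2, h, strangList, prodEvo, List.map_append, List.prod_append, List.map_reverse]

/-- The exponents of Suzuki's formulas. -/
def suzukiList (l : List (QOp n)) : ℕ → List (QOp n)
  | 0 => []
  | 1 => strangList l
  | m + 2 => suzukiStep (1 / (4 - (4 : ℝ) ^ ((1 : ℝ) / (2 * ((m : ℝ) + 2) - 1)))) (suzukiList l (m + 1))

lemma suzuki_eq {L : ℕ} (A : Fin L → QOp n) (q : ℕ) (t : ℝ) :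
    suzuki A q t = prodEvo (suzukiList (List.ofFn A) q) t := by
  induction q using Nat.strong_induction_on generalizing t with
  | _ q ih =>
    match q with
    | 0 => rfl
    | 1 => exact pf2_eq A t
    | m + 2 =>
      simp only [suzuki, suzukiList, prodEvo_suzukiStep, ih (m + 1) (by omega), pow_two, mul_assoc]

/-- Time symmetry is carried along with the order because each step of the recursion uses it to gain
the second of its two orders. -/
lemma hasOrder_suzukiList (l : List (QOp n)) (q : ℕ) :
    HasOrder (suzukiList l (q + 1)) l.sum (2 * (q + 1)) ∧
      ∀ t, prodEvo (suzukiList l (q + 1)) t * prodEvo (suzukiList l (q + 1)) (-t) = 1 := by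
  induction q with
  | zero =>
    refine ⟨?_, fun t => ?_⟩
    · have h := hasOrder_two (reverse_strangList l)
      rwa [sum_strangList] at h
    · have h := prodEvo_mul_reverse (strangList l) t
      rwa [reverse_strangList] at h
  | succ m ih => exact ⟨ih.1.suzukiStep ih.2 (suzuki_coeff_eq m), suzukiStep_symmetric ih.2⟩

/-- The total weight of each term in Suzuki's formulas. -/
def suzukiWeight : ℕ → ℝ
  | 0 => 0
  | 1 => 1
  | m + 2 =>
    let c : ℝ := 1 / (4 - (4 : ℝ) ^ ((1 : ℝ) / (2 * ((m : ℝ) + 2) - 1)))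
    (4 * |c| + |1 - 4 * c|) * suzukiWeight (m + 1)

lemma suzukiWeight_nonneg (q : ℕ) : 0 ≤ suzukiWeight (q + 1) := by
  induction q with
  | zero => simp [suzukiWeight]
  | succ q ih => exact mul_nonneg (by positivity) ih

variable {L : ℕ} (e : Fin L ≃ (Fin k → Fin n))

lemma sum_map_ofFn {M : Type*} [AddCommMonoid M] (φ : QOp n → M) :
    ((List.ofFn fun l => H.term (e l)).map φ).sum = ∑ j, φ (H.term j) := by
  rw [List.map_ofFn, List.sum_ofFn]
  exact Equiv.sum_comp e fun j => φ (H.term j)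

lemma sum_ofFn_term : (List.ofFn fun l => H.term (e l)).sum = H.total := by
  have h := H.sum_map_ofFn e id
  rwa [List.map_id] at h

lemma isStageList_ofFn : H.IsStageList (List.ofFn fun l => H.term (e l)) 1 where
  eq_smul X hX := by
    obtain ⟨l, rfl⟩ := (List.mem_ofFn' _ _).1 hX
    exact ⟨1, e l, by rw [one_smul]⟩
  weight φ _ := by rw [H.sum_map_ofFn e φ, one_mul]

lemma isStageList_strangList : H.IsStageList (strangList (List.ofFn fun l => H.term (e l))) 1 where
  eq_smul X hX := by
    rw [strangList, List.mem_append, List.mem_reverse, or_self] at hX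
    obtain ⟨Y, hY, rfl⟩ := List.mem_map.1 hX
    obtain ⟨a, j, rfl⟩ := (H.isStageList_ofFn e).eq_smul Y hY
    exact ⟨2⁻¹ * a, j, by rw [smul_smul]⟩
  weight φ hφ := by
    have h : (((List.ofFn fun l => H.term (e l)).map fun X => (2⁻¹ : ℝ) • X).map φ).sum =
        2⁻¹ * ∑ j, φ (H.term j) := by
      rw [List.map_map, show (φ ∘ fun X => (2⁻¹ : ℝ) • X) = fun X => 2⁻¹ * φ X from
        funext fun X => by simp [hφ], H.sum_map_ofFn e, Finset.mul_sum]
    rw [strangList, List.map_append, List.sum_append, List.map_reverse, List.sum_reverse, h]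
    ring

lemma isStageList_suzukiList (q : ℕ) :
    H.IsStageList (suzukiList (List.ofFn fun l => H.term (e l)) (q + 1)) (suzukiWeight (q + 1)) := by
  induction q with
  | zero => exact H.isStageList_strangList e
  | succ q ih => exact ih.suzukiStep _

end Formulas

end KLocalHamiltonian

namespace KLocalHamiltonian

open ProductFormula
open scoped Matrix.Norms.L2Operator

variable {n k : ℕ} (H : KLocalHamiltonian n k)

/-! ### Average and worst-case error bounds -/

section Average

/-- The constant of the trace inequality, for unsquared norms. -/
def traceConst (k : ℕ) : ℝ := Real.sqrt (4 * (2 * k) ^ k * k ^ 2)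

lemma traceConst_nonneg (k : ℕ) : 0 ≤ traceConst k := Real.sqrt_nonneg _

variable {H}

/-- An arbitrary set `J` is allowed because peeling off terms produces commutators with partial sums
of H. -/
lemma frobNorm_lie_sum_le (hH : H.ExactSupport) (i : Fin k → Fin n) (J : Finset (Fin k → Fin n)) :
    frobNorm ⁅H.term i, ∑ j ∈ J, H.term j⁆ ≤ traceConst k * frobNorm (H.term i) * H.permNorm := by
  have h := H.frobNorm_lie_sum_sq_le_permNorm hH i J
  have h0 : 0 ≤ frobNorm (H.term i) := frobNorm_nonneg _
  have h1 := H.permNorm_nonneg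
  refine (pow_le_pow_iff_left₀ (frobNorm_nonneg _)
    (mul_nonneg (mul_nonneg (traceConst_nonneg k) h0) h1) two_ne_zero).1 (h.trans (le_of_eq ?_))
  have hs : traceConst k ^ 2 = 4 * (2 * k) ^ k * k ^ 2 := Real.sq_sqrt (by positivity)
  rw [← hs]
  ring

lemma frobNorm_lie_le (A B : QOp n) : frobNorm ⁅A, B⁆ ≤ 2 * opNorm A * frobNorm B := by
  simpa only [norm_frobMap, opNorm_eq_norm] using isIdealNorm_frobMap.lie_le A B

lemma frobNorm_lie_le' (A B : QOp n) : frobNorm ⁅A, B⁆ ≤ 2 * opNorm B * frobNorm A := by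
  simpa only [norm_frobMap, opNorm_eq_norm] using isIdealNorm_frobMap.lie_le' B A

lemma frobNorm_add_le (A B : QOp n) : frobNorm (A + B) ≤ frobNorm A + frobNorm B := by
  simpa only [← norm_frobMap, map_add] using norm_add_le (frobMap A) (frobMap B)

lemma frobNorm_sum_le {α : Type*} (s : Finset α) (A : α → QOp n) :
    frobNorm (∑ a ∈ s, A a) ≤ ∑ a ∈ s, frobNorm (A a) := by
  simpa only [← norm_frobMap, map_sum] using norm_sum_le s fun a => frobMap (A a)

lemma frobNorm_lie_comm (A B : QOp n) : frobNorm ⁅A, B⁆ = frobNorm ⁅B, A⁆ := by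
  rw [← norm_frobMap, ← norm_frobMap, ← norm_neg, ← map_neg]
  congr 2
  rw [Ring.lie_def, Ring.lie_def, neg_sub]

/-- The contribution of the term `i` to the error of the second-order formula. -/
def strangBound (H : KLocalHamiltonian n k) (i : Fin k → Fin n) : ℝ :=
  2 * traceConst k * H.permNorm * (opNorm (H.term i) * frobNorm (H.term i) +
    ∑ m with ¬Disjoint (tupleSet m) (tupleSet i),
      (opNorm (H.term i) * frobNorm (H.term m) + opNorm (H.term m) * frobNorm (H.term i)))

lemma frobNorm_double_lie_le (hH : H.ExactSupport) (i : Fin k → Fin n)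
    (J : Finset (Fin k → Fin n)) :
    frobNorm ⁅H.term i, ⁅H.term i, ∑ j ∈ J, H.term j⁆⁆ +
      frobNorm ⁅∑ j ∈ J, H.term j, ⁅∑ j ∈ J, H.term j, H.term i⁆⁆ ≤ H.strangBound i := by
  set A := H.term i with hA
  set B := ∑ j ∈ J, H.term j with hB
  have hc := traceConst_nonneg k
  have hp := H.permNorm_nonneg
  have h1 : frobNorm ⁅A, ⁅A, B⁆⁆ ≤ 2 * opNorm A * (traceConst k * frobNorm A * H.permNorm) :=
    (frobNorm_lie_le _ _).trans (mul_le_mul_of_nonneg_left (frobNorm_lie_sum_le hH i J)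
      (mul_nonneg zero_le_two (norm_nonneg _)))
  have h2 : ⁅B, A⁆ = ∑ m ∈ J with ¬Disjoint (tupleSet m) (tupleSet i), ⁅H.term m, A⁆ := by
    rw [Finset.sum_filter, hB]
    simp only [Ring.lie_def, Finset.mul_sum, Finset.sum_mul, ← Finset.sum_sub_distrib]
    refine Finset.sum_congr rfl fun j _ => ?_
    split_ifs with h
    · rw [((H.actsWithin j).commute h (H.actsWithin i)).eq, sub_self]
    · rfl
  -- Expand the inner commutator over the terms meeting A and apply the Jacobi identity. Each
  -- summand then contains a commutator of a single term with all of B, to which the trace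
  -- inequality applies; the sum over m costs |||H|||₁.
  have h3 : ⁅B, ⁅B, A⁆⁆ = ∑ m ∈ J with ¬Disjoint (tupleSet m) (tupleSet i),
      (⁅⁅B, H.term m⁆, A⁆ + ⁅H.term m, ⁅B, A⁆⁆) := by
    rw [h2]
    conv_lhs => rw [Ring.lie_def, Finset.mul_sum, Finset.sum_mul, ← Finset.sum_sub_distrib]
    rw [← h2]
    refine Finset.sum_congr rfl fun m _ => ?_
    simp only [Ring.lie_def]
    noncomm_ring
  have h4 : ∀ m, frobNorm (⁅⁅B, H.term m⁆, A⁆ + ⁅H.term m, ⁅B, A⁆⁆) ≤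
      2 * traceConst k * H.permNorm *
        (opNorm A * frobNorm (H.term m) + opNorm (H.term m) * frobNorm A) := by
    intro m
    refine (frobNorm_add_le _ _).trans ?_
    have h5 : frobNorm ⁅⁅B, H.term m⁆, A⁆ ≤
        2 * opNorm A * (traceConst k * frobNorm (H.term m) * H.permNorm) := by
      refine (frobNorm_lie_le' _ _).trans (mul_le_mul_of_nonneg_left ?_
        (mul_nonneg zero_le_two (norm_nonneg _)))
      rw [frobNorm_lie_comm]
      exact frobNorm_lie_sum_le hH m J
    have h6 : frobNorm ⁅H.term m, ⁅B, A⁆⁆ ≤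
        2 * opNorm (H.term m) * (traceConst k * frobNorm A * H.permNorm) := by
      refine (frobNorm_lie_le _ _).trans (mul_le_mul_of_nonneg_left ?_
        (mul_nonneg zero_le_two (norm_nonneg _)))
      rw [frobNorm_lie_comm]
      exact frobNorm_lie_sum_le hH i J
    linarith
  have h7 : frobNorm ⁅B, ⁅B, A⁆⁆ ≤ 2 * traceConst k * H.permNorm *
      ∑ m with ¬Disjoint (tupleSet m) (tupleSet i),
        (opNorm A * frobNorm (H.term m) + opNorm (H.term m) * frobNorm A) := by
    rw [h3, Finset.mul_sum]
    refine (frobNorm_sum_le _ _).trans ((Finset.sum_le_sum fun m _ => h4 m).trans ?_)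
    refine Finset.sum_le_sum_of_subset_of_nonneg
      (Finset.filter_subset_filter _ (Finset.subset_univ _)) fun m _ _ => ?_
    have h8 : 0 ≤ opNorm A := norm_nonneg _
    have h9 : 0 ≤ opNorm (H.term m) := norm_nonneg _
    have := frobNorm_nonneg A
    have := frobNorm_nonneg (H.term m)
    positivity
  rw [strangBound, mul_add]
  refine add_le_add (h1.trans (le_of_eq ?_)) h7
  ring

lemma sum_strangBound_le (hk : 1 ≤ k) : ∑ i, H.strangBound i ≤
    traceConst k * (2 + 4 * k ^ 2) * (H.oneFrobNorm * H.inducedOneNorm * H.permNorm) := by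
  have hΛ := H.inducedOneNorm_nonneg
  have hp := H.permNorm_nonneg
  have hc := traceConst_nonneg k
  have h1 : ∑ i, opNorm (H.term i) * frobNorm (H.term i) ≤ H.inducedOneNorm * H.oneFrobNorm := by
    rw [oneFrobNorm, Finset.mul_sum]
    exact Finset.sum_le_sum fun i _ => mul_le_mul_of_nonneg_right
      (H.opNorm_le_inducedOneNorm hk i) (frobNorm_nonneg _)
  have h2 : ∑ i, ∑ m with ¬Disjoint (tupleSet m) (tupleSet i),
      opNorm (H.term m) * frobNorm (H.term i) ≤ k ^ 2 * H.inducedOneNorm * H.oneFrobNorm := by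
    rw [oneFrobNorm, Finset.mul_sum]
    refine Finset.sum_le_sum fun i _ => ?_
    rw [← Finset.sum_mul]
    refine mul_le_mul_of_nonneg_right ((H.sum_meets_le_inducedOneNorm _).trans ?_)
      (frobNorm_nonneg _)
    have : ((tupleSet i).card : ℝ) ≤ k := by exact_mod_cast card_tupleSet_le i
    rw [sq]
    gcongr
  -- Meeting is a symmetric relation, so i and m may be exchanged and both halves of `strangBound`
  -- give the same sum.
  have h3 : ∑ i, ∑ m with ¬Disjoint (tupleSet m) (tupleSet i),
      opNorm (H.term i) * frobNorm (H.term m) = ∑ i, ∑ m with ¬Disjoint (tupleSet m) (tupleSet i),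
      opNorm (H.term m) * frobNorm (H.term i) := by
    simp only [Finset.sum_filter]
    rw [Finset.sum_comm]
    simp only [disjoint_comm]
  calc ∑ i, H.strangBound i = 2 * traceConst k * H.permNorm *
        (∑ i, opNorm (H.term i) * frobNorm (H.term i) +
          2 * ∑ i, ∑ m with ¬Disjoint (tupleSet m) (tupleSet i),
            opNorm (H.term m) * frobNorm (H.term i)) := by
        simp only [strangBound]
        rw [← Finset.mul_sum, Finset.sum_add_distrib]
        simp only [Finset.sum_add_distrib]
        rw [h3, two_mul (∑ i, ∑ m with _, _)]
    _ ≤ 2 * traceConst k * H.permNorm * (H.inducedOneNorm * H.oneFrobNorm +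
          2 * (k ^ 2 * H.inducedOneNorm * H.oneFrobNorm)) := by gcongr
    _ = _ := by ring

/-- Error of the first-order formula for a sublist of the terms. -/
lemma frobNorm_prodEvo_sub_evo_le (hH : H.ExactSupport) {l : List (Fin k → Fin n)} (hl : l.Nodup)
    {t : ℝ} (ht : 0 ≤ t) :
    frobNorm (prodEvo (l.map H.term) t - evo (l.map H.term).sum t) ≤
      (l.map fun i => traceConst k * frobNorm (H.term i) * H.permNorm).sum * t ^ 2 := by
  induction l with
  | nil => simp [← norm_frobMap]
  | cons i l ih =>
    specialize ih hl.of_cons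
    have hA := H.isSelfAdjoint_term i
    -- The absence of repetitions turns the tail into a sum over a set of tuples, which is where the
    -- trace inequality is available; the commutator with the whole tail is never split.
    have hB : (l.map H.term).sum = ∑ j ∈ l.toFinset, H.term j := (List.sum_toFinset _ hl.of_cons).symm
    have hBs : IsSelfAdjoint (l.map H.term).sum := by
      rw [hB]; exact isSelfAdjoint_sum _ fun j _ => H.isSelfAdjoint_term j
    simp only [List.map_cons, prodEvo_cons, List.sum_cons]
    have h1 := isIdealNorm_frobMap.trotter_two_le hA hBs ht
    have h2 := isIdealNorm_frobMap.unitary_mul (evo_mem_unitary hA t)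
      (prodEvo (l.map H.term) t - evo (l.map H.term).sum t)
    rw [norm_frobMap, norm_frobMap] at h1 h2
    have h3 : evo (H.term i) t * prodEvo (l.map H.term) t - evo (H.term i + (l.map H.term).sum) t =
        evo (H.term i) t * (prodEvo (l.map H.term) t - evo (l.map H.term).sum t) +
        (evo (H.term i) t * evo (l.map H.term).sum t - evo (H.term i + (l.map H.term).sum) t) := by
      noncomm_ring
    have h4 := frobNorm_lie_sum_le hH i l.toFinset
    rw [← hB] at h4
    have h5 : frobNorm ⁅H.term i, (l.map H.term).sum⁆ * t ^ 2 ≤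
        traceConst k * frobNorm (H.term i) * H.permNorm * t ^ 2 := by gcongr
    rw [h3]
    refine (frobNorm_add_le _ _).trans ?_
    rw [add_mul]
    linarith

lemma prodEvo_strangList_cons (X : QOp n) (l : List (QOp n)) (t : ℝ) :
    prodEvo (strangList (X :: l)) t =
      evo ((2⁻¹ : ℝ) • X) t * (prodEvo (strangList l) t * evo ((2⁻¹ : ℝ) • X) t) := by
  simp [strangList, prodEvo_append, mul_assoc]

/-- Error of the second-order formula for a sublist of the terms. -/
lemma frobNorm_strangList_sub_evo_le (hH : H.ExactSupport) {l : List (Fin k → Fin n)}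
    (hl : l.Nodup) {t : ℝ} (ht : 0 ≤ t) :
    frobNorm (prodEvo (strangList (l.map H.term)) t - evo (l.map H.term).sum t) ≤
      (l.map H.strangBound).sum * t ^ 3 := by
  induction l with
  | nil => simp [← norm_frobMap, strangList]
  | cons i l ih =>
    specialize ih hl.of_cons
    have hA := H.isSelfAdjoint_term i
    have hA' : IsSelfAdjoint ((2⁻¹ : ℝ) • H.term i) := (IsSelfAdjoint.all _).smul hA
    have hB : (l.map H.term).sum = ∑ j ∈ l.toFinset, H.term j := (List.sum_toFinset _ hl.of_cons).symm
    have hBs : IsSelfAdjoint (l.map H.term).sum := by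
      rw [hB]; exact isSelfAdjoint_sum _ fun j _ => H.isSelfAdjoint_term j
    simp only [List.map_cons, prodEvo_strangList_cons, List.sum_cons]
    have h1 := isIdealNorm_frobMap.strang_le hA hBs ht
    set U := evo ((2⁻¹ : ℝ) • H.term i) t with hU
    set D := prodEvo (strangList (l.map H.term)) t - evo (l.map H.term).sum t with hD
    have h2 : frobNorm (U * (D * U)) ≤ frobNorm D := by
      have h := (isIdealNorm_frobMap.unitary_mul (evo_mem_unitary hA' t) (D * U)).trans
        (isIdealNorm_frobMap.mul_unitary (evo_mem_unitary hA' t) D)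
      rwa [norm_frobMap, norm_frobMap] at h
    simp only [norm_frobMap] at h1
    have h3 : U * (prodEvo (strangList (l.map H.term)) t * U) -
        evo (H.term i + (l.map H.term).sum) t = U * (D * U) +
        (U * (evo (l.map H.term).sum t * U) - evo (H.term i + (l.map H.term).sum) t) := by
      rw [hD]
      noncomm_ring
    have h4 := frobNorm_double_lie_le hH i l.toFinset
    rw [← hB] at h4
    have h5 := mul_le_mul_of_nonneg_right h4 (pow_nonneg ht 3)
    rw [h3]
    refine (frobNorm_add_le _ _).trans ?_
    rw [add_mul]
    linarith

variable {L : ℕ} (e : Fin L ≃ (Fin k → Fin n))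

lemma ofFn_term_eq_map : (List.ofFn fun l => H.term (e l)) = (List.ofFn e).map H.term := by
  rw [List.map_ofFn]; rfl

lemma sum_map_ofFn_equiv (φ : (Fin k → Fin n) → ℝ) : ((List.ofFn e).map φ).sum = ∑ j, φ j := by
  rw [List.map_ofFn, List.sum_ofFn]
  exact Equiv.sum_comp e φ

lemma avgError_pf1_le (hH : H.ExactSupport) {μ : Measure (QState n)} (hμ : IsOneDesign μ) {t : ℝ}
    (ht : 0 ≤ t) {r : ℕ} (hr : 1 ≤ r) :
    avgError μ (pf1 (fun l => H.term (e l)) (t / r) ^ r) (evolution H.total t) ≤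
      traceConst k * (t ^ 2 / r * (1 / Real.sqrt ((2 : ℝ) ^ n) * H.oneFrobNorm * H.permNorm)) := by
  refine (avgError_le μ hμ _ _).trans ?_
  have h := isIdealNorm_frobMap.steps_le (p := 1) (H.isStageList_ofFn e).isSelfAdjoint
    H.isSelfAdjoint_total (B := traceConst k * H.oneFrobNorm * H.permNorm) (fun s hs => by
      have h1 := frobNorm_prodEvo_sub_evo_le hH (List.nodup_ofFn.2 e.injective) hs
      rw [sum_map_ofFn_equiv e, ← ofFn_term_eq_map e, H.sum_ofFn_term e, ← Finset.sum_mul,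
        ← Finset.mul_sum] at h1
      rw [norm_frobMap]
      exact h1) ht hr
  rw [norm_frobMap, pow_one] at h
  rw [pf1_eq, evolution_eq_evo]
  calc _ ≤ 1 / Real.sqrt ((2 : ℝ) ^ n) *
        (t ^ (1 + 1) / r * (traceConst k * H.oneFrobNorm * H.permNorm)) := by gcongr
    _ = _ := by ring

lemma avgError_pf2_le (hk : 1 ≤ k) (hH : H.ExactSupport) {μ : Measure (QState n)}
    (hμ : IsOneDesign μ) {t : ℝ} (ht : 0 ≤ t) {r : ℕ} (hr : 1 ≤ r) :
    avgError μ (pf2 (fun l => H.term (e l)) (t / r) ^ r) (evolution H.total t) ≤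
      traceConst k * (2 + 4 * k ^ 2) * (t ^ 3 / (r : ℝ) ^ 2 *
        (1 / Real.sqrt ((2 : ℝ) ^ n) * H.oneFrobNorm * H.inducedOneNorm * H.permNorm)) := by
  refine (avgError_le μ hμ _ _).trans ?_
  have h := isIdealNorm_frobMap.steps_le (p := 2) (H.isStageList_strangList e).isSelfAdjoint
    H.isSelfAdjoint_total (B := traceConst k * (2 + 4 * k ^ 2) *
      (H.oneFrobNorm * H.inducedOneNorm * H.permNorm)) (fun s hs => by
      have h1 := frobNorm_strangList_sub_evo_le hH (List.nodup_ofFn.2 e.injective) hs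
      rw [sum_map_ofFn_equiv e, ← ofFn_term_eq_map e, H.sum_ofFn_term e] at h1
      rw [norm_frobMap]
      exact h1.trans (mul_le_mul_of_nonneg_right (sum_strangBound_le hk) (by positivity))) ht hr
  rw [norm_frobMap] at h
  rw [pf2_eq, evolution_eq_evo]
  calc _ ≤ 1 / Real.sqrt ((2 : ℝ) ^ n) * (t ^ (2 + 1) / r ^ 2 * (traceConst k * (2 + 4 * k ^ 2) *
      (H.oneFrobNorm * H.inducedOneNorm * H.permNorm))) := by gcongr
    _ = _ := by ring

lemma avgError_suzuki_le (q : ℕ) {μ : Measure (QState n)} (hμ : IsOneDesign μ) {t : ℝ}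
    (ht : 0 ≤ t) {r : ℕ} (hr : 1 ≤ r) :
    avgError μ (suzuki (fun l => H.term (e l)) (q + 1) (t / r) ^ r) (evolution H.total t) ≤
      stageConst k (suzukiWeight (q + 1)) (2 * (q + 1)) *
        (t ^ (2 * (q + 1) + 1) / (r : ℝ) ^ (2 * (q + 1)) *
          (1 / Real.sqrt ((2 : ℝ) ^ n) * H.oneFrobNorm * H.inducedOneNorm ^ (2 * (q + 1)))) := by
  refine (avgError_le μ hμ _ _).trans ?_
  have hord := (hasOrder_suzukiList (List.ofFn fun l => H.term (e l)) q).1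
  rw [H.sum_ofFn_term e] at hord
  have h := (H.isStageList_suzukiList e q).error_le isIdealNorm_frobMap (suzukiWeight_nonneg q)
    (by omega) hord ht hr
  simp only [norm_frobMap] at h
  rw [suzuki_eq, evolution_eq_evo]
  calc _ ≤ 1 / Real.sqrt ((2 : ℝ) ^ n) * _ := mul_le_mul_of_nonneg_left h (by positivity)
    _ = _ := by rw [oneFrobNorm]; ring

lemma worstError_pf1_le {t : ℝ} (ht : 0 ≤ t) {r : ℕ} (hr : 1 ≤ r) :
    worstError (pf1 (fun l => H.term (e l)) (t / r) ^ r) (evolution H.total t) ≤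
      stageConst k 1 1 * (t ^ 2 / r * (H.oneNorm * H.inducedOneNorm)) := by
  have hord := hasOrder_one (List.ofFn fun l => H.term (e l))
  rw [H.sum_ofFn_term e] at hord
  have h := (H.isStageList_ofFn e).error_le isIdealNorm_id zero_le_one le_rfl hord ht hr
  rw [pow_one, pow_one] at h
  rw [pf1_eq, evolution_eq_evo]
  exact h

lemma worstError_suzuki_le (q : ℕ) {t : ℝ} (ht : 0 ≤ t) {r : ℕ} (hr : 1 ≤ r) :
    worstError (suzuki (fun l => H.term (e l)) (q + 1) (t / r) ^ r) (evolution H.total t) ≤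
      stageConst k (suzukiWeight (q + 1)) (2 * (q + 1)) *
        (t ^ (2 * (q + 1) + 1) / (r : ℝ) ^ (2 * (q + 1)) *
          (H.oneNorm * H.inducedOneNorm ^ (2 * (q + 1)))) := by
  have hord := (hasOrder_suzukiList (List.ofFn fun l => H.term (e l)) q).1
  rw [H.sum_ofFn_term e] at hord
  have h := (H.isStageList_suzukiList e q).error_le isIdealNorm_id (suzukiWeight_nonneg q)
    (by omega) hord ht hr
  rw [suzuki_eq, evolution_eq_evo]
  exact h

end Average

end KLocalHamiltonian

end

/-! ### Exponents of n, and assembly of the theorem -/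

namespace KLocalHamiltonian

/-- Since n may be 0, adding real exponents requires them to be nonnegative; this uses k ≥ 1. -/
lemma pow_mul_rpow_half {n k : ℕ} (hk : 1 ≤ k) :
    (n : ℝ) ^ k * (n : ℝ) ^ (((k : ℝ) - 1) / 2) = (n : ℝ) ^ ((3 * (k : ℝ) - 1) / 2) := by
  have hk' : (1 : ℝ) ≤ k := by exact_mod_cast hk
  rw [← Real.rpow_natCast, ← Real.rpow_add_of_nonneg (Nat.cast_nonneg n) (by linarith) (by linarith)]
  congr 1; ring

lemma pow_mul_rpow_sub_one {n k : ℕ} (hk : 1 ≤ k) :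
    (n : ℝ) ^ k * (n : ℝ) ^ ((k : ℝ) - 1) = (n : ℝ) ^ (2 * (k : ℝ) - 1) := by
  have hk' : (1 : ℝ) ≤ k := by exact_mod_cast hk
  rw [← Real.rpow_natCast, ← Real.rpow_add_of_nonneg (Nat.cast_nonneg n) (by linarith) (by linarith)]
  congr 1; ring

lemma pow_mul_rpow_sub_one_sq {n k : ℕ} (hk : 1 ≤ k) :
    (n : ℝ) ^ k * ((n : ℝ) ^ ((k : ℝ) - 1)) ^ 2 = (n : ℝ) ^ (3 * (k : ℝ) - 2) := by
  have hk' : (1 : ℝ) ≤ k := by exact_mod_cast hk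
  rw [sq, ← mul_assoc, pow_mul_rpow_sub_one hk,
    ← Real.rpow_add_of_nonneg (Nat.cast_nonneg n) (by linarith) (by linarith)]
  congr 1; ring

lemma pow_mul_rpow_sub_one_mul_rpow_half {n k : ℕ} (hk : 1 ≤ k) :
    (n : ℝ) ^ k * (n : ℝ) ^ ((k : ℝ) - 1) * (n : ℝ) ^ (((k : ℝ) - 1) / 2) =
      (n : ℝ) ^ ((5 * (k : ℝ) - 3) / 2) := by
  have hk' : (1 : ℝ) ≤ k := by exact_mod_cast hk
  rw [pow_mul_rpow_sub_one hk,
    ← Real.rpow_add_of_nonneg (Nat.cast_nonneg n) (by linarith) (by linarith)]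
  congr 1; ring

lemma inducedOneNorm_le_rpow {n k : ℕ} (H : KLocalHamiltonian n k) (hk : 1 ≤ k)
    (h : ∀ j, opNorm (H.term j) ≤ 1) : H.inducedOneNorm ≤ (n : ℝ) ^ ((k : ℝ) - 1) := by
  have h1 := H.inducedOneNorm_le h
  rwa [← Real.rpow_natCast, Nat.cast_sub hk, Nat.cast_one] at h1

end KLocalHamiltonian

theorem mainTheorem7 (k : ℕ) (hk : 1 ≤ k) :
    -- the trace inequality
    (∃ C : ℝ, 0 < C ∧ ∀ (n : ℕ) (H : KLocalHamiltonian n k), H.ExactSupport →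
      ∀ i : Fin k → Fin n,
        frobNorm ⁅H.term i, ∑ j, H.term j⁆ ^ 2
          ≤ C * frobNorm (H.term i) ^ 2 * H.permNorm ^ 2) ∧
    -- the trace inequality with its explicit constant, for single-qubit overlaps
    (∀ (n : ℕ) (H : KLocalHamiltonian n k), H.ExactSupport →
      ∀ i : Fin k → Fin n,
        frobNorm ⁅H.term i,
            ∑ j with Function.Injective j ∧ (tupleSet j ∩ tupleSet i).card = 1, H.term j⁆ ^ 2
          ≤ 4 * (k : ℝ) ^ 4 * frobNorm (H.term i) ^ 2 * H.permNorm ^ 2) ∧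
    -- average error of the first- and second-order formulas
    (∃ C : ℝ, 0 < C ∧ ∀ (n : ℕ) (H : KLocalHamiltonian n k), H.ExactSupport →
      ∀ (L : ℕ) (e : Fin L ≃ (Fin k → Fin n)) (μ : MeasureTheory.Measure (QState n)),
        IsOneDesign μ → ∀ (t : ℝ) (r : ℕ), 0 ≤ t → 1 ≤ r →
          avgError μ (pf1 (fun l => H.term (e l)) (t / r) ^ r) (evolution H.total t)
            ≤ C * (t ^ 2 / r * (1 / Real.sqrt ((2 : ℝ) ^ n) * H.oneFrobNorm * H.permNorm)) ∧
          avgError μ (pf2 (fun l => H.term (e l)) (t / r) ^ r) (evolution H.total t)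
            ≤ C * (t ^ 3 / (r : ℝ) ^ 2 * (1 / Real.sqrt ((2 : ℝ) ^ n) * H.oneFrobNorm *
                H.inducedOneNorm * H.permNorm))) ∧
    -- average error of the formulas of order `p = 2q > 2`
    (∀ q : ℕ, 2 ≤ q → ∃ C : ℝ, 0 < C ∧ ∀ (n : ℕ) (H : KLocalHamiltonian n k)
      (L : ℕ) (e : Fin L ≃ (Fin k → Fin n)) (μ : MeasureTheory.Measure (QState n)),
        IsOneDesign μ → ∀ (t : ℝ) (r : ℕ), 0 ≤ t → 1 ≤ r →
          avgError μ (suzuki (fun l => H.term (e l)) q (t / r) ^ r) (evolution H.total t)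
            ≤ C * (t ^ (2 * q + 1) / (r : ℝ) ^ (2 * q) *
                (1 / Real.sqrt ((2 : ℝ) ^ n) * H.oneFrobNorm * H.inducedOneNorm ^ (2 * q)))) ∧
    -- worst-case error of the first-order formula
    (∃ C : ℝ, 0 < C ∧ ∀ (n : ℕ) (H : KLocalHamiltonian n k)
      (L : ℕ) (e : Fin L ≃ (Fin k → Fin n)) (t : ℝ) (r : ℕ), 0 ≤ t → 1 ≤ r →
        worstError (pf1 (fun l => H.term (e l)) (t / r) ^ r) (evolution H.total t)
          ≤ C * (t ^ 2 / r * (H.oneNorm * H.inducedOneNorm))) ∧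
    -- worst-case error of the formulas of order `p = 2q ≥ 2`
    (∀ q : ℕ, 1 ≤ q → ∃ C : ℝ, 0 < C ∧ ∀ (n : ℕ) (H : KLocalHamiltonian n k)
      (L : ℕ) (e : Fin L ≃ (Fin k → Fin n)) (t : ℝ) (r : ℕ), 0 ≤ t → 1 ≤ r →
        worstError (suzuki (fun l => H.term (e l)) q (t / r) ^ r) (evolution H.total t)
          ≤ C * (t ^ (2 * q + 1) / (r : ℝ) ^ (2 * q) *
              (H.oneNorm * H.inducedOneNorm ^ (2 * q)))) ∧
    -- terms of norm at most one: the norms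
    (∃ C : ℝ, 0 < C ∧ ∀ (n : ℕ) (H : KLocalHamiltonian n k), (∀ j, opNorm (H.term j) ≤ 1) →
      H.oneNorm ≤ (n : ℝ) ^ k ∧
      1 / Real.sqrt ((2 : ℝ) ^ n) * H.oneFrobNorm ≤ (n : ℝ) ^ k ∧
      H.permNorm ≤ C * (n : ℝ) ^ (((k : ℝ) - 1) / 2) ∧
      H.inducedOneNorm ≤ C * (n : ℝ) ^ ((k : ℝ) - 1)) ∧
    -- terms of norm at most one: average error
    (∃ C : ℝ, 0 < C ∧ ∀ (n : ℕ) (H : KLocalHamiltonian n k), H.ExactSupport →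
      (∀ j, opNorm (H.term j) ≤ 1) →
      ∀ (L : ℕ) (e : Fin L ≃ (Fin k → Fin n)) (μ : MeasureTheory.Measure (QState n)),
        IsOneDesign μ → ∀ (t : ℝ) (r : ℕ), 0 ≤ t → 1 ≤ r →
          avgError μ (pf1 (fun l => H.term (e l)) (t / r) ^ r) (evolution H.total t)
            ≤ C * (t ^ 2 / r * (n : ℝ) ^ ((3 * (k : ℝ) - 1) / 2)) ∧
          avgError μ (pf2 (fun l => H.term (e l)) (t / r) ^ r) (evolution H.total t)
            ≤ C * (t ^ 3 / (r : ℝ) ^ 2 * (n : ℝ) ^ ((5 * (k : ℝ) - 3) / 2))) ∧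
    -- terms of norm at most one: worst-case error
    (∃ C : ℝ, 0 < C ∧ ∀ (n : ℕ) (H : KLocalHamiltonian n k), (∀ j, opNorm (H.term j) ≤ 1) →
      ∀ (L : ℕ) (e : Fin L ≃ (Fin k → Fin n)) (t : ℝ) (r : ℕ), 0 ≤ t → 1 ≤ r →
          worstError (pf1 (fun l => H.term (e l)) (t / r) ^ r) (evolution H.total t)
            ≤ C * (t ^ 2 / r * (n : ℝ) ^ (2 * (k : ℝ) - 1)) ∧
          worstError (pf2 (fun l => H.term (e l)) (t / r) ^ r) (evolution H.total t)
            ≤ C * (t ^ 3 / (r : ℝ) ^ 2 * (n : ℝ) ^ (3 * (k : ℝ) - 2))) := by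
  have hT := KLocalHamiltonian.traceConst_nonneg k
  have hS1 := KLocalHamiltonian.stageConst_nonneg k zero_le_one 1
  have hSz := fun q => KLocalHamiltonian.stageConst_nonneg k
    (KLocalHamiltonian.suzukiWeight_nonneg q) (2 * (q + 1))
  -- The constants obtained are only known to be nonnegative; adding 1 makes them positive.
  have enlarge : ∀ {c x y : ℝ}, 0 ≤ y → x ≤ c * y → x ≤ (c + 1) * y := fun hy h => by linarith
  have hd : ∀ n : ℕ, 0 ≤ 1 / Real.sqrt ((2 : ℝ) ^ n) := fun n => by positivity
  refine ⟨?_, fun n H hH i => H.frobNorm_lie_sum_sq_le_of_single_overlap hH i, ?_, ?_, ?_, ?_, ?_,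
    ?_, ?_⟩
  · refine ⟨4 * (2 * k) ^ k * k ^ 2, by positivity, fun n H hH i => ?_⟩
    exact H.frobNorm_lie_sum_sq_le_permNorm hH i Finset.univ
  · refine ⟨KLocalHamiltonian.traceConst k * (2 + 4 * k ^ 2) + 1, by positivity,
      fun n H hH L e μ hμ t r ht hr => ?_⟩
    have := H.oneFrobNorm_nonneg
    have := H.inducedOneNorm_nonneg
    have := H.permNorm_nonneg
    have := hd n
    refine ⟨enlarge (by positivity) ?_, enlarge (by positivity)
      (KLocalHamiltonian.avgError_pf2_le e hk hH hμ ht hr)⟩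
    refine (KLocalHamiltonian.avgError_pf1_le e hH hμ ht hr).trans
      (mul_le_mul_of_nonneg_right ?_ (by positivity))
    refine le_mul_of_one_le_right hT ?_
    have : (0 : ℝ) ≤ k ^ 2 := by positivity
    linarith
  · intro q hq
    obtain ⟨q, rfl⟩ : ∃ m, q = m + 1 := ⟨q - 1, by omega⟩
    refine ⟨_ + 1, add_pos_of_nonneg_of_pos (hSz q) one_pos,
      fun n H L e μ hμ t r ht hr => enlarge ?_ (KLocalHamiltonian.avgError_suzuki_le e q hμ ht hr)⟩
    have := H.oneFrobNorm_nonneg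
    have := H.inducedOneNorm_nonneg
    have := hd n
    positivity
  · refine ⟨_ + 1, add_pos_of_nonneg_of_pos hS1 one_pos,
      fun n H L e t r ht hr => enlarge ?_ (KLocalHamiltonian.worstError_pf1_le e ht hr)⟩
    have := H.oneNorm_nonneg
    have := H.inducedOneNorm_nonneg
    positivity
  · intro q hq
    obtain ⟨q, rfl⟩ : ∃ m, q = m + 1 := ⟨q - 1, by omega⟩
    refine ⟨_ + 1, add_pos_of_nonneg_of_pos (hSz q) one_pos,
      fun n H L e t r ht hr => enlarge ?_ (KLocalHamiltonian.worstError_suzuki_le e q ht hr)⟩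
    have := H.oneNorm_nonneg
    have := H.inducedOneNorm_nonneg
    positivity
  · refine ⟨Real.sqrt (((k : ℝ) + 1) ^ k) + 1, by positivity, fun n H h =>
      ⟨H.oneNorm_le h, H.oneFrobNorm_le h, enlarge (by positivity) (H.permNorm_le hk h), ?_⟩⟩
    have h1 := H.inducedOneNorm_le_rpow hk h
    have h2 : (0 : ℝ) ≤ (n : ℝ) ^ ((k : ℝ) - 1) := by positivity
    exact h1.trans (le_mul_of_one_le_left h2 (by linarith [Real.sqrt_nonneg (((k : ℝ) + 1) ^ k)]))
  · refine ⟨KLocalHamiltonian.traceConst k * (2 + 4 * k ^ 2) * Real.sqrt (((k : ℝ) + 1) ^ k) + 1,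
      by positivity, fun n H hH h L e μ hμ t r ht hr => ?_⟩
    have h1 := H.oneFrobNorm_nonneg
    have h2 := H.inducedOneNorm_nonneg
    have h3 := H.permNorm_nonneg
    have h4 := hd n
    have h5 := H.oneFrobNorm_le h
    have h6 := H.permNorm_le hk h
    have h7 := H.inducedOneNorm_le_rpow hk h
    refine ⟨enlarge (by positivity) ?_, enlarge (by positivity) ?_⟩
    · refine (KLocalHamiltonian.avgError_pf1_le e hH hμ ht hr).trans ?_
      calc _ ≤ KLocalHamiltonian.traceConst k * (2 + 4 * k ^ 2) * (t ^ 2 / r *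
            ((n : ℝ) ^ k * (Real.sqrt (((k : ℝ) + 1) ^ k) * (n : ℝ) ^ (((k : ℝ) - 1) / 2)))) := by
            have h8 : KLocalHamiltonian.traceConst k ≤
                KLocalHamiltonian.traceConst k * (2 + 4 * k ^ 2) :=
              le_mul_of_one_le_right hT (by nlinarith [sq_nonneg (k : ℝ)])
            gcongr
        _ = _ := by rw [← KLocalHamiltonian.pow_mul_rpow_half hk]; ring
    · refine (KLocalHamiltonian.avgError_pf2_le e hk hH hμ ht hr).trans ?_
      calc _ ≤ KLocalHamiltonian.traceConst k * (2 + 4 * k ^ 2) * (t ^ 3 / (r : ℝ) ^ 2 *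
            ((n : ℝ) ^ k * (n : ℝ) ^ ((k : ℝ) - 1) *
              (Real.sqrt (((k : ℝ) + 1) ^ k) * (n : ℝ) ^ (((k : ℝ) - 1) / 2)))) := by
            gcongr
        _ = _ := by rw [← KLocalHamiltonian.pow_mul_rpow_sub_one_mul_rpow_half hk]; ring
  · refine ⟨KLocalHamiltonian.stageConst k 1 1 +
      KLocalHamiltonian.stageConst k (KLocalHamiltonian.suzukiWeight 1) 2 + 1,
      by have := hSz 0; positivity, fun n H h L e t r ht hr => ?_⟩
    have hS2 : 0 ≤ KLocalHamiltonian.stageConst k (KLocalHamiltonian.suzukiWeight 1) 2 := hSz 0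
    have h1 := H.oneNorm_nonneg
    have h2 := H.inducedOneNorm_nonneg
    have h5 := H.oneNorm_le h
    have h7 := H.inducedOneNorm_le_rpow hk h
    refine ⟨enlarge (by positivity) ?_, enlarge (by positivity) ?_⟩
    · refine (KLocalHamiltonian.worstError_pf1_le e ht hr).trans ?_
      rw [← KLocalHamiltonian.pow_mul_rpow_sub_one hk]
      have h8 : KLocalHamiltonian.stageConst k 1 1 ≤ KLocalHamiltonian.stageConst k 1 1 +
        KLocalHamiltonian.stageConst k (KLocalHamiltonian.suzukiWeight 1) 2 := by linarith
      gcongr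
    -- The second-order formula is `suzuki` at index 1 by definition, so the general bound applies
    -- with q = 0.
    · refine (KLocalHamiltonian.worstError_suzuki_le e 0 ht hr).trans ?_
      rw [← KLocalHamiltonian.pow_mul_rpow_sub_one_sq hk]
      have h8 : KLocalHamiltonian.stageConst k (KLocalHamiltonian.suzukiWeight 1) 2 ≤
        KLocalHamiltonian.stageConst k 1 1 +
        KLocalHamiltonian.stageConst k (KLocalHamiltonian.suzukiWeight 1) 2 := by linarith
      change KLocalHamiltonian.stageConst k (KLocalHamiltonian.suzukiWeight 1) 2 *
        (t ^ 3 / (r : ℝ) ^ 2 * (H.oneNorm * H.inducedOneNorm ^ 2)) ≤ _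
      gcongr
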